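/- Let $\mathcal{P}_m$ be the cone of real symmetric positive definite $m\times m$ matrices, with the Riemannian metric $d_R(A,B)=\big(\sum_{j=1}^m[\log\lambda_j(A^{-1/2}BA^{-1/2})]^2\big)^{1/2}$, where $\lambda_1,\dots,\lambda_m$ denote the eigenvalues. A random matrix $X$ in $\mathcal{P}_m$ is called orthogonally invariant if $X$ and $kXk'$ have the same distribution for every orthogonal $m\times m$ matrix $k$. Let $X_1,X_2,\dots$ be independent, identically distributed, orthogonally invariant random matrices in $\mathcal{P}_m$. Put $A\circ B=A^{1/2}BA^{1/2}$, $S_1=X_1$, $S_{j+1}=S_j\circ X_{j+1}$ for $j\ge1$, and for $n\ge 1$ let $$M_n=\max_{1\le j\le n}d_R(I_m,X_j),\qquad U_n=\max_{1\le j\le n}d_R(I_m,S_j).$$ Let $n,l,n_1,\dots,n_l\ge 1$ be integers, let $t_0,t_1,\dots,t_l\in[0,\infty)$, and put $K=n_1+\cdots+n_l$ and $$\mathcal{I}_0=\Big\{1\le i\le l:\ [\mathbb{P}(U_n\le t_i)]^{n_i-\delta_{i1}}\le\frac1{n_i!}\Big\},$$ where $\delta_{i1}$ is Kronecker's delta.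 Let $\chi(1\notin\mathcal{I}_0)$ equal $1$ if $1\notin\mathcal{I}_0$ and $0$ otherwise. If $K\le n+1$, then $$\mathbb{P}\Big(U_n>(K-1)t_0+(2n_1-1)t_1+2\sum_{j=2}^l n_jt_j\Big)\le\mathbb{P}(M_n>t_0)+[\mathbb{P}(U_n\le t_1)]^{\chi(1\notin\mathcal{I}_0)}\prod_{j\in\mathcal{I}_0}[\mathbb{P}(U_n>t_j)]^{n_j}\prod_{\substack{1\le j\le l\\ j\notin\mathcal{I}_0}}\frac1{n_j!}\Big(\frac{\mathbb{P}(U_n>t_j)}{\mathbb{P}(U_n\le t_j)}\Big)^{n_j}.$$ Further, let $Y_{(1)}\le\cdots\le Y_{(n)}$ be the order statistics of $d_R(I_m,X_1),\dots,d_R(I_m,X_n)$. Then the inequality remains true, and is at least as strong, if $\mathbb{P}(M_n>t_0)$ is replaced by $$\mathbb{P}\Big(\sum_{j=n-K+2}^nY_{(j)}>(K-1)t_0\Big);$$ that is, this probability is at most $\mathbb{P}(M_n>t_0)$. -/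

import Mathlib

open MeasureTheory ProbabilityTheory

noncomputable section

/-- The cone `P_m` of real symmetric positive definite `m × m` matrices. -/
abbrev PosDefMatrix (m : ℕ) : Type := {A : Matrix (Fin m) (Fin m) ℝ // A.PosDef}

namespace PosDefMatrix

variable {m : ℕ}

/-- `P_m` carries the Borel σ-algebra of its usual topology (entrywise convergence). -/
instance : MeasurableSpace (PosDefMatrix m) := borel _

instance : BorelSpace (PosDefMatrix m) := ⟨rfl⟩

/-- The identity matrix `I_m` as a point of the cone. -/
def one (m : ℕ) : PosDefMatrix m := ⟨1, Matrix.PosDef.one⟩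

open scoped MatrixOrder in
/-- The unique positive definite square root `A^{1/2}`. -/
def sqrt (A : PosDefMatrix m) : PosDefMatrix m :=
  ⟨CFC.sqrt A.1, Matrix.isStrictlyPositive_iff_posDef.mp
    (IsStrictlyPositive.sqrt A.1 (Matrix.isStrictlyPositive_iff_posDef.mpr A.2))⟩

theorem posDef_mul_mul_self (C B : PosDefMatrix m) : (C.1 * B.1 * C.1).PosDef := by
  have h := B.2.conjTranspose_mul_mul_same (B := C.1)
    (Matrix.mulVec_injective_iff_isUnit.mpr C.2.isUnit)
  rwa [C.2.isHermitian.eq] at h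

/-- The inverse `A⁻¹` as a point of the cone. -/
def inv (A : PosDefMatrix m) : PosDefMatrix m := ⟨A.1⁻¹, A.2.inv⟩

/-- `A ∘ B = A^{1/2} B A^{1/2}`. -/
def circ (A B : PosDefMatrix m) : PosDefMatrix m :=
  ⟨A.sqrt.1 * B.1 * A.sqrt.1, posDef_mul_mul_self A.sqrt B⟩

/-- The action `A ↦ k A k'` of an orthogonal matrix `k`. -/
def conj (k : Matrix.orthogonalGroup (Fin m) ℝ) (A : PosDefMatrix m) : PosDefMatrix m :=
  ⟨k.1 * A.1 * k.1.transpose, by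
    have hk : IsUnit k.1.transpose :=
      IsUnit.of_mul_eq_one k.1 ((Matrix.mem_orthogonalGroup_iff' (Fin m) ℝ).mp k.2)
    have h := A.2.conjTranspose_mul_mul_same (B := k.1.transpose)
      (Matrix.mulVec_injective_iff_isUnit.mpr hk)
    rwa [Matrix.conjTranspose_eq_transpose_of_trivial, Matrix.transpose_transpose] at h⟩

/-- The Riemannian metric
`d_R(A, B) = (∑ j, (log λ_j(A^{-1/2} B A^{-1/2}))²)^{1/2}`, eigenvalues with multiplicity. -/
def riemannianDist (A B : PosDefMatrix m) : ℝ :=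
  Real.sqrt (∑ j : Fin m,
    (Real.log ((posDef_mul_mul_self A.sqrt.inv B).isHermitian.eigenvalues j)) ^ 2)

end PosDefMatrix

section RandomWalk

variable {m : ℕ} {Ω : Type*}

/-- A random matrix `X` in `P_m` is orthogonally invariant if `X` and `k X k'` have the same law
for every orthogonal `k`. -/
def OrthogonallyInvariant [MeasurableSpace Ω] (P : Measure Ω) (X : Ω → PosDefMatrix m) : Prop :=
  ∀ k : Matrix.orthogonalGroup (Fin m) ℝ,
    IdentDistrib (fun ω => PosDefMatrix.conj k (X ω)) X P P

/-- The partial products. The sequence is indexed from `0`, so that `X i` is the `(i+1)`-st step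
and `partialCirc X i ω` is `S_{i+1} = X_1 ∘ ⋯ ∘ X_{i+1}`, bracketed to the left. -/
def partialCirc (X : ℕ → Ω → PosDefMatrix m) : ℕ → Ω → PosDefMatrix m
  | 0, ω => X 0 ω
  | i + 1, ω => (partialCirc X i ω).circ (X (i + 1) ω)

/-- `Y_j = d_R(I_m, X_j)` for the first `n` steps. -/
def stepDist (X : ℕ → Ω → PosDefMatrix m) (n : ℕ) (ω : Ω) (i : Fin n) : ℝ :=
  (PosDefMatrix.one m).riemannianDist (X i ω)

/-- `M_n`, the maximum of `d_R(I_m, X_1), …, d_R(I_m, X_n)` (used for `n ≥ 1`). -/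
def maxStep (X : ℕ → Ω → PosDefMatrix m) (n : ℕ) (ω : Ω) : ℝ :=
  ⨆ i : Fin n, stepDist X n ω i

/-- `U_n`, the maximum of `d_R(I_m, S_1), …, d_R(I_m, S_n)` (used for `n ≥ 1`). -/
def maxWalk (X : ℕ → Ω → PosDefMatrix m) (n : ℕ) (ω : Ω) : ℝ :=
  ⨆ i : Fin n, (PosDefMatrix.one m).riemannianDist (partialCirc X i ω)

end RandomWalk

/-- The order statistics of `y_1, …, y_n`: the same values, with multiplicity, in nondecreasing
order. The entry with index `i : Fin n` is `y_{(i+1)}`. -/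
def orderStat {n : ℕ} (y : Fin n → ℝ) : Fin n → ℝ := y ∘ Tuple.sort y

/-- The sum `∑_{j = n-K+2}^{n} y_(j)` of the `K - 1` largest order statistics, for
`1 ≤ K ≤ n + 1`. The condition `n + 2 ≤ (i + 1) + K` says `n - K + 2 ≤ i + 1`. -/
def topOrderStatSum {n : ℕ} (y : Fin n → ℝ) (K : ℕ) : ℝ :=
  ∑ i : Fin n with n + 2 ≤ (i.val + 1) + K, orderStat y i

/-- The set `I_0 ⊆ {1, …, l}` of the indices `i` with
`P(U ≤ t_i)^{ν_i - δ_{i1}} ≤ 1 / ν_i!`. -/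
def indexSet {Ω : Type*} [MeasurableSpace Ω] (P : Measure Ω) (U : Ω → ℝ)
    (l : ℕ) (ν : ℕ → ℕ) (t : ℕ → ℝ) : Finset ℕ :=
  open Classical in
  {i ∈ Finset.Icc 1 l |
    P.real {ω | U ω ≤ t i} ^ (ν i - if i = 1 then 1 else 0) ≤ 1 / ((ν i).factorial : ℝ)}

/-- The term
`P(U ≤ t_1)^{χ(1 ∉ I_0)} ∏_{j ∈ I_0} P(U > t_j)^{ν_j}
  ∏_{j ∉ I_0} (1 / ν_j!) (P(U > t_j) / P(U ≤ t_j))^{ν_j}`,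
where `j` ranges over `{1, …, l}`. -/
def hjProduct {Ω : Type*} [MeasurableSpace Ω] (P : Measure Ω) (U : Ω → ℝ)
    (l : ℕ) (ν : ℕ → ℕ) (t : ℕ → ℝ) : ℝ :=
  P.real {ω | U ω ≤ t 1} ^ (if 1 ∉ indexSet P U l ν t then 1 else 0) *
    (∏ j ∈ indexSet P U l ν t, P.real {ω | t j < U ω} ^ ν j) *
    ∏ j ∈ Finset.Icc 1 l \ indexSet P U l ν t,
      1 / ((ν j).factorial : ℝ) *
        (P.real {ω | t j < U ω} / P.real {ω | U ω ≤ t j}) ^ ν j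

end

/-!
The proof is the Hoffmann-Jørgensen first-passage argument, carried out for a walk whose increments
are independent only after a change of frame.

*First passages.* Let `D j k = d_R(S_j, S_k)`. Run through a list of thresholds: `t_1` once, then
`2 t_1` repeated `n_1 - 1` times, then `2 t_j` repeated `n_j` times for `j ≥ 2`; each time wait until
the walk is further from its position at the previous passage than the current threshold
(`passageChain`). If the `K` passages are not all completed by time `n`, the triangle inequality
bounds `U_n` by the sum of the thresholds plus at most `K - 1` steps, hence by the sum of the
`K - 1` largest steps (`IsIncrementArray.exists_le_sum_of_notMem_passageChain`). If they are
completed, independence of the increments makes the probability an iterated sum of first-passage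
probabilities. A restarted passage over `2t` forces the walk to exceed `t`, which yields the factors
`P(U_n > t)`. It also yields more: on the independent event that the walk stays in the `t`-ball up
to the restart, the walk's own first passage over `t` falls between the restart and the passage over
`2t`, so restarted passage times have cumulative sums dominated by those of
`P(first passage over t at k) / P(U_n ≤ t)` (`IsIncrementArray.real_compl_exceeds_mul_le`). By Abel
summation the iterated sum then runs over increasing tuples for one fixed sequence of weights,
which is the origin of `1 / n_j!`. Only independence enters here, not the equality of the laws.

*Independent increments.* The operation `∘` is not associative, and `d_R(S_j, S_k)` is not a
function of the steps between `j` and `k`. However `S_i^{1/2} u_i = Z_0^{1/2} ⋯ Z_{i-1}^{1/2}`, where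
`u_i` is the orthogonal matrix accumulated from the `gyration`s and `Z_i = u_i' X_i u_i`. As `d_R` is
invariant under congruences, `d_R(S_j, S_k)` is a function of `Z_j, …, Z_{k-1}`
(`riemannianDist_walk_add`). As `u_i` depends on the past only and `X_i` is orthogonally invariant,
the `Z_i` are independent (`iIndep_rotatedStep`), and `d_R(I, Z_i) = d_R(I, X_i)`.

*The metric.* The triangle inequality for `d_R` reduces by congruence to
`‖log(e^{x/2} Q e^{x/2})‖ ≤ ‖log Q‖ + ‖x‖` in the Frobenius norm, with `x` diagonal. Along
`C_s = e^{sx/2} Q e^{sx/2}` the derivative of `‖log C_s‖²` is `2 tr(x log C_s)`, at most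
`2 ‖x‖ ‖log C_s‖` (`exists_hasDerivAt_logSq_expScaling`). The derivative of the spectral function
comes from averaging the scalar Taylor formula over the doubly stochastic matrix that compares two
eigenbases (`eventually_abs_logSq_sub_le`), which also gives the continuity of `d_R(I, ·)` and of
the square root.
-/

/-! ### The sum of squared logarithms of the eigenvalues -/

section SpectralSum

open Matrix Filter Topology

variable {n : Type*} [Fintype n] [DecidableEq n]

/-- The sum of `(log λ)²` over the eigenvalues `λ` of `A`, with multiplicity. Reading it off the
characteristic polynomial makes it invariant under similarity by definition. -/
noncomputable def logSq (A : Matrix n n ℝ) : ℝ :=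
  (A.charpoly.roots.map fun x => Real.log x ^ 2).sum

theorem logSq_mul_comm (A B : Matrix n n ℝ) : logSq (A * B) = logSq (B * A) := by
  rw [logSq, logSq, charpoly_mul_comm]

theorem logSq_diagonal (a : n → ℝ) : logSq (diagonal a) = ∑ i, Real.log (a i) ^ 2 := by
  rw [logSq, charpoly_diagonal, Polynomial.roots_prod _ _
    (Finset.prod_ne_zero_iff.mpr fun i _ => Polynomial.X_sub_C_ne_zero _)]
  simp

theorem logSq_conj_diagonal {U : Matrix n n ℝ} (hU : Uᵀ * U = 1) (a : n → ℝ) :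
    logSq (U * diagonal a * Uᵀ) = ∑ i, Real.log (a i) ^ 2 := by
  rw [logSq_mul_comm, ← mul_assoc, hU, one_mul, logSq_diagonal]

theorem logSq_eq_sum_eigenvalues {A : Matrix n n ℝ} (hA : A.IsHermitian) :
    logSq A = ∑ i, Real.log (hA.eigenvalues i) ^ 2 := by
  rw [logSq, hA.roots_charpoly_eq_eigenvalues]
  simp

theorem Matrix.PosDef.exists_eq_conj_diagonal {A : Matrix n n ℝ} (hA : A.PosDef) :
    ∃ (U : Matrix n n ℝ) (a : n → ℝ), Uᵀ * U = 1 ∧ U * Uᵀ = 1 ∧ (∀ i, 0 < a i) ∧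
      A = U * diagonal a * Uᵀ := by
  have h := hA.isHermitian.spectral_theorem
  rw [Unitary.conjStarAlgAut_apply] at h
  refine ⟨hA.isHermitian.eigenvectorUnitary, hA.isHermitian.eigenvalues, ?_, ?_,
    hA.eigenvalues_pos, ?_⟩
  · exact (Unitary.mem_iff.mp hA.isHermitian.eigenvectorUnitary.2).1
  · exact (Unitary.mem_iff.mp hA.isHermitian.eigenvectorUnitary.2).2
  · exact h

theorem Matrix.posDef_conj_diagonal {U : Matrix n n ℝ} (hU : U * Uᵀ = 1) {a : n → ℝ}
    (ha : ∀ i, 0 < a i) : (U * diagonal a * Uᵀ).PosDef := by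
  have h := (posDef_diagonal_iff.mpr ha).conjTranspose_mul_mul_same (B := Uᵀ)
    (mulVec_injective_iff_isUnit.mpr (IsUnit.of_mul_eq_one U
      (mul_eq_one_comm.mp hU)))
  rwa [conjTranspose_eq_transpose_of_trivial, transpose_transpose] at h

theorem Matrix.PosDef.transpose_mul_mul_same {A : Matrix n n ℝ} (hA : A.PosDef) {M : Matrix n n ℝ}
    (hM : IsUnit M) : (Mᵀ * A * M).PosDef := by
  have h := hA.conjTranspose_mul_mul_same (B := M) (mulVec_injective_iff_isUnit.mpr hM)
  rwa [conjTranspose_eq_transpose_of_trivial] at h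

/-- The trace pairing of two symmetric matrices in terms of their spectral decompositions. -/
theorem trace_conj_diagonal_mul (U V : Matrix n n ℝ) (a b : n → ℝ) :
    trace (U * diagonal a * Uᵀ * (V * diagonal b * Vᵀ))
      = ∑ i, ∑ j, (Uᵀ * V) i j ^ 2 * (a i * b j) := by
  have h : trace (U * diagonal a * Uᵀ * (V * diagonal b * Vᵀ))
      = trace (diagonal a * (Uᵀ * V) * (diagonal b * (Uᵀ * V)ᵀ)) := by
    rw [transpose_mul, transpose_transpose, trace_mul_comm, ← mul_assoc, ← mul_assoc, trace_mul_comm]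
    simp only [← mul_assoc]
    rw [trace_mul_comm]
    simp only [mul_assoc]
  rw [h, trace]
  refine Finset.sum_congr rfl fun i _ => ?_
  rw [diag_apply, mul_apply]
  refine Finset.sum_congr rfl fun j _ => ?_
  rw [diagonal_mul, diagonal_mul, transpose_apply]
  ring

theorem sum_sq_row_eq_one {W : Matrix n n ℝ} (hW : W * Wᵀ = 1) (i : n) : ∑ j, W i j ^ 2 = 1 := by
  have h := congrFun (congrFun hW i) i
  rw [mul_apply, one_apply_eq] at h
  simpa [sq] using h

theorem sum_sq_col_eq_one {W : Matrix n n ℝ} (hW : Wᵀ * W = 1) (j : n) : ∑ i, W i j ^ 2 = 1 := by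
  have h := congrFun (congrFun hW j) j
  rw [mul_apply, one_apply_eq] at h
  simpa [sq] using h

/-- Two spectral decompositions `A = U diag(a) Uᵀ` and `B = V diag(b) Vᵀ` are compared through a
doubly stochastic matrix `w`, the entrywise square of `Uᵀ V`. -/
theorem exists_doublyStochastic {U V : Matrix n n ℝ} (hU : Uᵀ * U = 1) (hV : Vᵀ * V = 1) :
    ∃ w : n → n → ℝ, (∀ i j, 0 ≤ w i j) ∧ (∀ i, ∑ j, w i j = 1) ∧ (∀ j, ∑ i, w i j = 1) ∧
      ∀ a b : n → ℝ, trace (U * diagonal a * Uᵀ * (V * diagonal b * Vᵀ))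
        = ∑ i, ∑ j, w i j * (a i * b j) := by
  have hU' : U * Uᵀ = 1 := mul_eq_one_comm.mp hU
  have hV' : V * Vᵀ = 1 := mul_eq_one_comm.mp hV
  refine ⟨fun i j => (Uᵀ * V) i j ^ 2, fun i j => sq_nonneg _, sum_sq_row_eq_one ?_,
    sum_sq_col_eq_one ?_, trace_conj_diagonal_mul U V⟩
  · rw [transpose_mul, transpose_transpose, mul_assoc, ← mul_assoc V, hV', one_mul, hU]
  · rw [transpose_mul, transpose_transpose, mul_assoc, ← mul_assoc U, hU', one_mul, hV]

theorem trace_conj_diagonal_mul_self {U : Matrix n n ℝ} (hU : Uᵀ * U = 1) (a b : n → ℝ) :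
    trace (U * diagonal a * Uᵀ * (U * diagonal b * Uᵀ)) = ∑ i, a i * b i := by
  have : U * diagonal a * Uᵀ * (U * diagonal b * Uᵀ)
      = U * (diagonal a * (Uᵀ * U) * diagonal b * Uᵀ) := by simp only [mul_assoc]
  rw [this, hU, mul_one, trace_mul_comm, mul_assoc, hU, mul_one, diagonal_mul_diagonal,
    trace_diagonal]

theorem sum_sum_weight_left {ι : Type*} [Fintype ι] {w : ι → ι → ℝ} (hw : ∀ i, ∑ j, w i j = 1)
    (f : ι → ℝ) :
    ∑ i, ∑ j, w i j * f i = ∑ i, f i := by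
  simp only [← Finset.sum_mul, hw, one_mul]

theorem sum_sum_weight_right {ι : Type*} [Fintype ι] {w : ι → ι → ℝ} (hw : ∀ j, ∑ i, w i j = 1)
    (f : ι → ℝ) :
    ∑ i, ∑ j, w i j * f j = ∑ j, f j := by
  rw [Finset.sum_comm]
  simp only [← Finset.sum_mul, hw, one_mul]

/-- Second-order Taylor bound for `(log y)²` at `x`, on a half-line bounded away from `0`. -/
theorem abs_log_sq_sub_le {α L x y : ℝ} (hα : 0 < α) (hx : α ≤ x) (hy : α ≤ y)
    (hL : |Real.log x| ≤ L) :
    |Real.log y ^ 2 - Real.log x ^ 2 - 2 * (Real.log x / x * (y - x))|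
      ≤ (1 + 2 * L) / α ^ 2 * (y - x) ^ 2 := by
  have hx0 : 0 < x := hα.trans_le hx
  have hy0 : 0 < y := hα.trans_le hy
  have hz : 0 < y / x := div_pos hy0 hx0
  have h1 : Real.log y - Real.log x ≤ (y - x) / x := by
    rw [← Real.log_div hy0.ne' hx0.ne']
    have := Real.log_le_sub_one_of_pos hz
    rwa [sub_div, div_self hx0.ne']
  have h2 : (y - x) / y ≤ Real.log y - Real.log x := by
    have := Real.log_le_sub_one_of_pos (inv_pos.mpr hz)
    rw [Real.log_inv, Real.log_div hy0.ne' hx0.ne', inv_div] at this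
    rw [sub_div, div_self hy0.ne']
    linarith
  set δ := Real.log y - Real.log x with hδ
  have hq : (y - x) / x - (y - x) / y = (y - x) ^ 2 / (x * y) := by
    field_simp
  have hxy : (y - x) ^ 2 / (x * y) ≤ (y - x) ^ 2 / α ^ 2 := by
    have : α ^ 2 ≤ x * y := by nlinarith
    gcongr
  have hδ2 : δ ^ 2 ≤ (y - x) ^ 2 / α ^ 2 := by
    have habs : |δ| ≤ |y - x| / α := by
      rw [abs_le']
      constructor
      · calc δ ≤ (y - x) / x := h1
          _ ≤ |y - x| / x := by gcongr; exact le_abs_self _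
          _ ≤ |y - x| / α := by gcongr
      · calc -δ ≤ -(y - x) / y := by rw [neg_div]; linarith
          _ ≤ |y - x| / y := by gcongr; exact neg_le_abs _
          _ ≤ |y - x| / α := by gcongr
    rw [← sq_abs δ, ← sq_abs (y - x), ← div_pow]
    gcongr
  have hr : |δ - (y - x) / x| ≤ (y - x) ^ 2 / α ^ 2 := by
    rw [abs_le]
    constructor <;> nlinarith [div_nonneg (sq_nonneg (y - x)) (sq_nonneg α)]
  have hid : Real.log y ^ 2 - Real.log x ^ 2 - 2 * (Real.log x / x * (y - x))
      = δ ^ 2 + 2 * Real.log x * (δ - (y - x) / x) := by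
    rw [hδ]; field_simp; ring
  rw [hid]
  calc |δ ^ 2 + 2 * Real.log x * (δ - (y - x) / x)|
      ≤ δ ^ 2 + 2 * |Real.log x| * |δ - (y - x) / x| := by
        refine (abs_add_le _ _).trans ?_
        rw [abs_mul, abs_mul, abs_of_nonneg (sq_nonneg δ), abs_two]
    _ ≤ (y - x) ^ 2 / α ^ 2 + 2 * L * ((y - x) ^ 2 / α ^ 2) := by
        have : 0 ≤ L := (abs_nonneg _).trans hL
        gcongr
    _ = _ := by ring

theorem trace_sub_mul_self {U V : Matrix n n ℝ} (hU : Uᵀ * U = 1) (hV : Vᵀ * V = 1)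
    {w : n → n → ℝ} (hw₁ : ∀ i, ∑ j, w i j = 1) (hw₂ : ∀ j, ∑ i, w i j = 1) {a b : n → ℝ}
    (hw : trace (U * diagonal a * Uᵀ * (V * diagonal b * Vᵀ)) = ∑ i, ∑ j, w i j * (a i * b j)) :
    trace ((V * diagonal b * Vᵀ - U * diagonal a * Uᵀ) *
        (V * diagonal b * Vᵀ - U * diagonal a * Uᵀ))
      = ∑ i, ∑ j, w i j * (b j - a i) ^ 2 := by
  rw [sub_mul, mul_sub, mul_sub, trace_sub, trace_sub, trace_sub, trace_conj_diagonal_mul_self hV,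
    trace_conj_diagonal_mul_self hU, trace_mul_comm (V * diagonal b * Vᵀ), hw,
    ← sum_sum_weight_left hw₁ (fun i => a i * a i), ← sum_sum_weight_right hw₂ (fun j => b j * b j)]
  simp only [← Finset.sum_sub_distrib]
  refine Finset.sum_congr rfl fun i _ => Finset.sum_congr rfl fun j _ => ?_
  ring

theorem inv_conj_diagonal {U : Matrix n n ℝ} (hU : Uᵀ * U = 1) {a : n → ℝ} (ha : ∀ i, a i ≠ 0) :
    (U * diagonal a * Uᵀ)⁻¹ = U * diagonal (fun i => (a i)⁻¹) * Uᵀ := by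
  apply inv_eq_right_inv
  have : U * diagonal a * Uᵀ * (U * diagonal (fun i => (a i)⁻¹) * Uᵀ)
    = U * (diagonal a * (Uᵀ * U) * diagonal (fun i => (a i)⁻¹) * Uᵀ) := by simp only [mul_assoc]
  rw [this, hU, mul_one, diagonal_mul_diagonal]
  simp [ha, mul_eq_one_comm.mp hU]

/-- A bound on `tr(B⁻¹)` bounds the eigenvalues of `B` away from `0`. -/
theorem le_of_trace_inv_le {V : Matrix n n ℝ} (hV : Vᵀ * V = 1) {b : n → ℝ} (hb : ∀ i, 0 < b i)
    {τ : ℝ} (hτ : trace (V * diagonal b * Vᵀ)⁻¹ ≤ τ) (i : n) : τ⁻¹ ≤ b i := by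
  rw [inv_conj_diagonal hV fun i => (hb i).ne', trace_mul_comm, ← mul_assoc, hV, one_mul,
    trace_diagonal] at hτ
  have h1 : (b i)⁻¹ ≤ τ := (Finset.single_le_sum (f := fun i => (b i)⁻¹)
    (fun j _ => (inv_pos.mpr (hb j)).le) (Finset.mem_univ i)).trans hτ
  exact inv_le_of_inv_le₀ (hb i) h1

theorem continuousAt_trace_inv {A : Matrix n n ℝ} (hA : A.PosDef) :
    ContinuousAt (fun B : Matrix n n ℝ => trace B⁻¹) A := by
  have h : ContinuousAt (fun B : Matrix n n ℝ => (B.det)⁻¹ * trace B.adjugate) A := by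
    refine ContinuousAt.mul (ContinuousAt.inv₀ ?_ hA.det_pos.ne') ?_
    · exact (continuous_id.matrix_det).continuousAt
    · exact (continuous_id.matrix_adjugate.matrix_trace).continuousAt
  refine h.congr (Eventually.of_forall fun B => ?_)
  simp [inv_def]

/-- First-order expansion of the spectral function `logSq` at a positive definite matrix
`A = U diag(a) Uᵀ`: its gradient is `2 U diag(log a / a) Uᵀ`. Averaging the scalar Taylor bound
against the doubly stochastic matrix of `exists_doublyStochastic` leaves a remainder that is
quadratic in the Frobenius norm. -/
theorem eventually_abs_logSq_sub_le {U : Matrix n n ℝ} (hU : Uᵀ * U = 1) {a : n → ℝ}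
    (ha : ∀ i, 0 < a i) :
    ∃ c : ℝ, ∀ᶠ B in 𝓝 (U * diagonal a * Uᵀ), B.PosDef →
      |logSq B - logSq (U * diagonal a * Uᵀ)
        - 2 * trace (U * diagonal (fun i => Real.log (a i) / a i) * Uᵀ *
            (B - U * diagonal a * Uᵀ))|
        ≤ c * trace ((B - U * diagonal a * Uᵀ) * (B - U * diagonal a * Uᵀ)) := by
  have hA := posDef_conj_diagonal (mul_eq_one_comm.mp hU) ha
  set τ := |trace (U * diagonal a * Uᵀ)⁻¹| + 1 with hτ
  have hτ0 : 0 < τ := by positivity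
  set L := ∑ i, |Real.log (a i)| with hL
  refine ⟨(1 + 2 * L) / τ⁻¹ ^ 2, ?_⟩
  have hev : ∀ᶠ B in 𝓝 (U * diagonal a * Uᵀ), trace B⁻¹ < τ :=
    (continuousAt_trace_inv hA).eventually (gt_mem_nhds (by
      rw [hτ]; exact (le_abs_self _).trans_lt (lt_add_one _)))
  filter_upwards [hev] with B hB hBpos
  obtain ⟨V, b, hV, -, hb, rfl⟩ := hBpos.exists_eq_conj_diagonal
  obtain ⟨w, hw0, hw₁, hw₂, hw⟩ := exists_doublyStochastic hU hV
  have hαa : ∀ i, τ⁻¹ ≤ a i :=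
    le_of_trace_inv_le hU ha ((le_abs_self _).trans (lt_add_one _).le)
  have hαb : ∀ i, τ⁻¹ ≤ b i := le_of_trace_inv_le hV hb hB.le
  rw [trace_sub_mul_self hU hV hw₁ hw₂ (hw a b), logSq_conj_diagonal hU, logSq_conj_diagonal hV,
    mul_sub, trace_sub, hw, trace_conj_diagonal_mul_self hU]
  have hexp : ∑ j, Real.log (b j) ^ 2 - ∑ i, Real.log (a i) ^ 2
        - 2 * (∑ i, ∑ j, w i j * (Real.log (a i) / a i * b j)
          - ∑ i, Real.log (a i) / a i * a i)
      = ∑ i, ∑ j, w i j * (Real.log (b j) ^ 2 - Real.log (a i) ^ 2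
          - 2 * (Real.log (a i) / a i * (b j - a i))) := by
    rw [← sum_sum_weight_right hw₂ (fun j => Real.log (b j) ^ 2),
      ← sum_sum_weight_left hw₁ (fun i => Real.log (a i) ^ 2),
      ← sum_sum_weight_left hw₁ (fun i => Real.log (a i) / a i * a i)]
    simp only [← Finset.sum_sub_distrib, Finset.mul_sum]
    refine Finset.sum_congr rfl fun i _ => Finset.sum_congr rfl fun j _ => ?_
    ring
  rw [hexp, Finset.mul_sum]
  refine (Finset.abs_sum_le_sum_abs _ _).trans (Finset.sum_le_sum fun i _ => ?_)
  rw [Finset.mul_sum]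
  refine (Finset.abs_sum_le_sum_abs _ _).trans (Finset.sum_le_sum fun j _ => ?_)
  rw [abs_mul, abs_of_nonneg (hw0 i j), mul_left_comm (_ / _)]
  refine mul_le_mul_of_nonneg_left ?_ (hw0 i j)
  exact abs_log_sq_sub_le (inv_pos.mpr hτ0) (hαa i) (hαb j)
    (Finset.single_le_sum (f := fun i => |Real.log (a i)|) (fun _ _ => abs_nonneg _)
      (Finset.mem_univ i))

theorem continuous_logSq : Continuous fun A : {A : Matrix n n ℝ // A.PosDef} => logSq A.1 := by
  rw [continuous_iff_continuousAt]
  intro A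
  obtain ⟨U, a, hU, -, ha, hA⟩ := A.2.exists_eq_conj_diagonal
  obtain ⟨c, hc⟩ := eventually_abs_logSq_sub_le hU ha
  rw [← hA] at hc
  set G := U * diagonal (fun i => Real.log (a i) / a i) * Uᵀ
  have hval : ContinuousAt (fun B : {A : Matrix n n ℝ // A.PosDef} => B.1) A :=
    continuous_subtype_val.continuousAt
  have hc' : ∀ᶠ B : {A : Matrix n n ℝ // A.PosDef} in 𝓝 A,
      |logSq B.1 - (logSq A.1 + 2 * trace (G * (B.1 - A.1)))|
        ≤ c * trace ((B.1 - A.1) * (B.1 - A.1)) := by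
    filter_upwards [hval.eventually hc] with B hB
    rw [← sub_sub]
    exact hB B.2
  have hlin : Tendsto (fun B : {A : Matrix n n ℝ // A.PosDef} =>
      logSq A.1 + 2 * trace (G * (B.1 - A.1))) (𝓝 A) (𝓝 (logSq A.1)) := by
    have : Continuous fun B : {A : Matrix n n ℝ // A.PosDef} =>
      logSq A.1 + 2 * trace (G * (B.1 - A.1)) := by fun_prop
    simpa using this.tendsto A
  have hquad : Tendsto (fun B : {A : Matrix n n ℝ // A.PosDef} =>
      c * trace ((B.1 - A.1) * (B.1 - A.1))) (𝓝 A) (𝓝 0) := by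
    have : Continuous fun B : {A : Matrix n n ℝ // A.PosDef} =>
      c * trace ((B.1 - A.1) * (B.1 - A.1)) := by fun_prop
    simpa using this.tendsto A
  have := (squeeze_zero_norm' hc' hquad).add hlin
  simpa [ContinuousAt] using this

end SpectralSum

/-! ### Subadditivity along products -/

section GeodesicScaling

open Matrix Filter Topology

variable {n : Type*} [Fintype n] [DecidableEq n]

/-- The path `s ↦ exp(s x / 2) Q exp(s x / 2)` through `Q`, for the diagonal matrix with
diagonal `x`. -/
noncomputable def expScaling (Q : Matrix n n ℝ) (x : n → ℝ) (s : ℝ) : Matrix n n ℝ :=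
  diagonal (fun i => Real.exp (s * x i / 2)) * Q * diagonal fun i => Real.exp (s * x i / 2)

theorem expScaling_apply (Q : Matrix n n ℝ) (x : n → ℝ) (s : ℝ) (i j : n) :
    expScaling Q x s i j = Real.exp (s * ((x i + x j) / 2)) * Q i j := by
  rw [expScaling, mul_diagonal, diagonal_mul, mul_right_comm, ← Real.exp_add]
  congr 2
  ring

theorem expScaling_zero (Q : Matrix n n ℝ) (x : n → ℝ) : expScaling Q x 0 = Q := by
  ext i j
  simp [expScaling_apply]

theorem Matrix.PosDef.expScaling {Q : Matrix n n ℝ} (hQ : Q.PosDef) (x : n → ℝ) (s : ℝ) :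
    (expScaling Q x s).PosDef := by
  have h := hQ.transpose_mul_mul_same (M := diagonal fun i => Real.exp (s * x i / 2))
    (posDef_diagonal_iff.mpr fun i => Real.exp_pos _).isUnit
  rwa [diagonal_transpose] at h

theorem hasDerivAt_expScaling_apply (Q : Matrix n n ℝ) (x : n → ℝ) (t : ℝ) (i j : n) :
    HasDerivAt (fun s => expScaling Q x s i j) ((x i + x j) / 2 * expScaling Q x t i j) t := by
  have h := (((hasDerivAt_id t).mul_const ((x i + x j) / 2)).exp).mul_const (Q i j)
  simp only [expScaling_apply]
  refine h.congr_deriv ?_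
  simp only [id]
  ring

/-- A function dominated by a nonnegative one which vanishes to first order has derivative `0`. -/
theorem hasDerivAt_zero_of_abs_le {r e : ℝ → ℝ} {c t : ℝ} (he : HasDerivAt e 0 t) (he0 : e t = 0)
    (hr0 : r t = 0) (hr : ∀ᶠ s in 𝓝 t, |r s| ≤ c * e s) : HasDerivAt r 0 t := by
  rw [hasDerivAt_iff_isLittleO] at he ⊢
  simp only [he0, hr0, smul_zero, sub_zero] at he ⊢
  refine Asymptotics.IsBigO.trans_isLittleO (Asymptotics.IsBigO.of_bound |c| ?_) he
  filter_upwards [hr] with s hs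
  rw [Real.norm_eq_abs, Real.norm_eq_abs, ← abs_mul]
  exact hs.trans (le_abs_self _)

/-- Along `expScaling Q x`, the quantity `‖log ·‖²` has derivative `2 tr(x · log)`, so that
`‖log ·‖` grows at speed at most the Frobenius norm of `x`. -/
theorem exists_hasDerivAt_logSq_expScaling {Q : Matrix n n ℝ} (hQ : Q.PosDef) (x : n → ℝ) (t : ℝ) :
    ∃ d, HasDerivAt (fun s => logSq (expScaling Q x s)) d t ∧
      d ≤ 2 * √(logSq (expScaling Q x t)) * √(∑ i, x i ^ 2) := by
  obtain ⟨U, a, hU, hU', ha, hA⟩ := (hQ.expScaling x t).exists_eq_conj_diagonal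
  obtain ⟨c, hc⟩ := eventually_abs_logSq_sub_le hU ha
  rw [← hA] at hc
  set G := U * diagonal (fun i => Real.log (a i) / a i) * Uᵀ with hG
  set Λ := U * diagonal (fun i => Real.log (a i)) * Uᵀ with hΛ
  have hcont : ContinuousAt (expScaling Q x) t := by
    refine continuousAt_pi.mpr fun i => continuousAt_pi.mpr fun j => ?_
    exact (hasDerivAt_expScaling_apply Q x t i j).continuousAt
  have hbd : ∀ᶠ s in 𝓝 t, |logSq (expScaling Q x s) - logSq (expScaling Q x t)
        - 2 * trace (G * (expScaling Q x s - expScaling Q x t))|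
        ≤ c * trace ((expScaling Q x s - expScaling Q x t) *
          (expScaling Q x s - expScaling Q x t)) := by
    filter_upwards [hcont.eventually hc] with s hs using hs (hQ.expScaling x s)
  have hquad : HasDerivAt (fun s => trace ((expScaling Q x s - expScaling Q x t) *
          (expScaling Q x s - expScaling Q x t))) 0 t := by
    simp only [trace, diag_apply, mul_apply, Matrix.sub_apply]
    have : HasDerivAt (fun s => ∑ i, ∑ j, (expScaling Q x s i j - expScaling Q x t i j) *
        (expScaling Q x s j i - expScaling Q x t j i)) (∑ _i : n, ∑ _j : n, 0) t := by
      refine HasDerivAt.fun_sum fun i _ => HasDerivAt.fun_sum fun j _ => ?_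
      refine (((hasDerivAt_expScaling_apply Q x t i j).sub_const _).mul
        ((hasDerivAt_expScaling_apply Q x t j i).sub_const _)).congr_deriv ?_
      simp
    simpa using this
  have hlin : HasDerivAt (fun s => trace (G * (expScaling Q x s - expScaling Q x t)))
      (∑ i, ∑ j, G i j * ((x j + x i) / 2 * expScaling Q x t j i)) t := by
    simp only [trace, diag_apply, mul_apply, Matrix.sub_apply]
    refine HasDerivAt.fun_sum fun i _ => HasDerivAt.fun_sum fun j _ => ?_
    exact ((hasDerivAt_expScaling_apply Q x t j i).sub_const _).const_mul _
  have hr := hasDerivAt_zero_of_abs_le hquad (by simp) (by simp) hbd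
  have hder := (hr.add (hlin.const_mul 2)).add_const (logSq (expScaling Q x t))
  have hGC : G * expScaling Q x t = Λ := by
    have : G * (U * diagonal a * Uᵀ)
        = U * (diagonal (fun i => Real.log (a i) / a i) * (Uᵀ * U) * diagonal a * Uᵀ) := by
      simp only [hG, mul_assoc]
    rw [hA, this, hU, mul_one, diagonal_mul_diagonal, hΛ, mul_assoc]
    simp [div_mul_cancel₀ _ (ha _).ne']
  have hCG : expScaling Q x t * G = Λ := by
    have : U * diagonal a * Uᵀ * G
        = U * (diagonal a * (Uᵀ * U) * diagonal (fun i => Real.log (a i) / a i) * Uᵀ) := by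
      simp only [hG, mul_assoc]
    rw [hA, this, hU, mul_one, diagonal_mul_diagonal, hΛ, mul_assoc]
    simp [mul_div_cancel₀ _ (ha _).ne']
  have hval : ∑ i, ∑ j, G i j * ((x j + x i) / 2 * expScaling Q x t j i) = ∑ i, x i * Λ i i := by
    have h1 : ∑ i, ∑ j, x i * (G i j * expScaling Q x t j i) = ∑ i, x i * Λ i i := by
      simp only [← Finset.mul_sum, ← hGC, mul_apply]
    have h2 : ∑ i, ∑ j, x j * (expScaling Q x t j i * G i j) = ∑ i, x i * Λ i i := by
      rw [Finset.sum_comm]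
      simp only [← Finset.mul_sum, ← hCG, mul_apply]
    have h3 : ∑ i, x i * Λ i i = (∑ i, x i * Λ i i + ∑ i, x i * Λ i i) / 2 := by ring
    rw [h3]
    nth_rewrite 1 [← h1]
    rw [← h2]
    simp only [← Finset.sum_add_distrib, Finset.sum_div]
    refine Finset.sum_congr rfl fun i _ => Finset.sum_congr rfl fun j _ => ?_
    ring
  refine ⟨2 * ∑ i, x i * Λ i i, ?_, ?_⟩
  · refine (hder.congr_deriv (by rw [hval]; ring)).congr_of_eventuallyEq
      (Eventually.of_forall fun s => ?_)
    simp
  · have hΛt : Λᵀ = Λ := by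
      rw [hΛ, transpose_mul, transpose_mul, transpose_transpose, diagonal_transpose, mul_assoc]
    have hdiag : ∑ i, Λ i i ^ 2 ≤ logSq (expScaling Q x t) := by
      have h1 : logSq (expScaling Q x t) = trace (Λ * Λ) := by
        rw [hA, logSq_conj_diagonal hU, hΛ, trace_conj_diagonal_mul_self hU]
        simp only [sq]
      rw [h1, trace]
      refine Finset.sum_le_sum fun i _ => ?_
      rw [diag_apply, mul_apply]
      have h2 : ∀ j, Λ i j * Λ j i = Λ i j ^ 2 := fun j => by
        nth_rewrite 2 [← hΛt]
        rw [transpose_apply, sq]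
      simp only [h2]
      exact Finset.single_le_sum (f := fun j => Λ i j ^ 2) (fun j _ => sq_nonneg _)
        (Finset.mem_univ i)
    have hcs : ∑ i, x i * Λ i i ≤ √(∑ i, x i ^ 2) * √(∑ i, Λ i i ^ 2) :=
      Real.sum_mul_le_sqrt_mul_sqrt _ _ _
    calc 2 * ∑ i, x i * Λ i i ≤ 2 * (√(∑ i, x i ^ 2) * √(∑ i, Λ i i ^ 2)) := by gcongr
      _ ≤ 2 * (√(∑ i, x i ^ 2) * √(logSq (expScaling Q x t))) := by gcongr
      _ = _ := by ring

theorem logSq_nonneg (A : Matrix n n ℝ) : 0 ≤ logSq A :=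
  Multiset.sum_nonneg fun y hy => by
    obtain ⟨z, -, rfl⟩ := Multiset.mem_map.mp hy
    exact sq_nonneg _

/-- If `f ≥ 0` and `f' ≤ 2 ξ √f`, then `√f` increases by at most `ξ` over a unit interval. Since
`√f` need not be differentiable where `f` vanishes, the argument runs through `√(f + ε)`. -/
theorem sqrt_le_sqrt_add_of_deriv_le {f : ℝ → ℝ} {ξ : ℝ} (hξ : 0 ≤ ξ) (hf0 : ∀ t, 0 ≤ f t)
    (hf : ∀ t, ∃ d, HasDerivAt f d t ∧ d ≤ 2 * √(f t) * ξ) : √(f 1) ≤ √(f 0) + ξ := by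
  refine le_of_forall_pos_le_add fun ε hε => ?_
  have hpos : ∀ t, 0 < f t + ε ^ 2 := fun t => by have := hf0 t; positivity
  have hg : ∀ t, ∃ d, HasDerivAt (fun s => √(f s + ε ^ 2)) d t ∧ d ≤ ξ := fun t => by
    obtain ⟨d, hd, hle⟩ := hf t
    refine ⟨_, (hd.add_const (ε ^ 2)).sqrt (hpos t).ne', ?_⟩
    have hs : 0 < √(f t + ε ^ 2) := Real.sqrt_pos.mpr (hpos t)
    rw [div_le_iff₀ (by positivity)]
    refine hle.trans ?_
    have : √(f t) ≤ √(f t + ε ^ 2) := Real.sqrt_le_sqrt (by nlinarith)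
    nlinarith
  choose d hd hle using hg
  have hmv := image_sub_le_mul_sub_of_deriv_le (f := fun s => √(f s + ε ^ 2)) (C := ξ)
    (fun t => (hd t).differentiableAt) (fun t => (hd t).deriv ▸ hle t) (zero_le_one (α := ℝ))
  simp only [sub_zero, mul_one] at hmv
  have h1 : √(f 1) ≤ √(f 1 + ε ^ 2) := Real.sqrt_le_sqrt (by nlinarith)
  have h0 : √(f 0 + ε ^ 2) ≤ √(f 0) + ε := by
    rw [Real.sqrt_le_left (by positivity), add_sq, Real.sq_sqrt (hf0 0)]
    have := mul_nonneg (Real.sqrt_nonneg (f 0)) hε.le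
    linarith
  linarith

/-- Subadditivity of `‖log ·‖` along products: the eigenvalues of `P Q` for positive definite
`P` and `Q`. Diagonalizing `P` as `exp x`, the matrix `P Q` is similar to the endpoint of
`expScaling`. -/
theorem sqrt_logSq_mul_le {P Q : Matrix n n ℝ} (hP : P.PosDef) (hQ : Q.PosDef) :
    √(logSq (P * Q)) ≤ √(logSq P) + √(logSq Q) := by
  obtain ⟨U, a, hU, hU', ha, rfl⟩ := hP.exists_eq_conj_diagonal
  have hUunit : IsUnit U := IsUnit.of_mul_eq_one Uᵀ hU'
  set R := Uᵀ * Q * U with hR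
  have hRpos : R.PosDef := hQ.transpose_mul_mul_same hUunit
  have h := sqrt_le_sqrt_add_of_deriv_le (Real.sqrt_nonneg _) (fun t => logSq_nonneg _)
    (exists_hasDerivAt_logSq_expScaling hRpos fun i => Real.log (a i))
  have h1 : logSq (expScaling R (fun i => Real.log (a i)) 1)
      = logSq (U * diagonal a * Uᵀ * Q) := by
    have hd : (diagonal fun i => Real.exp (1 * Real.log (a i) / 2)) *
        (diagonal fun i => Real.exp (1 * Real.log (a i) / 2)) = diagonal a := by
      rw [diagonal_mul_diagonal]
      congr 1
      ext i
      rw [← Real.exp_add, one_mul, add_halves, Real.exp_log (ha i)]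
    rw [expScaling, mul_assoc, logSq_mul_comm, mul_assoc, hd, logSq_mul_comm, hR,
      mul_assoc U, mul_assoc U, logSq_mul_comm U]
    simp only [mul_assoc]
  have h0 : logSq R = logSq Q := by
    rw [hR, logSq_mul_comm, ← mul_assoc, hU', one_mul]
  rw [h1, expScaling_zero, h0] at h
  rw [logSq_conj_diagonal hU, add_comm]
  exact h

end GeodesicScaling

/-! ### The Riemannian distance and the square root -/

namespace PosDefMatrix

open Matrix Filter Topology

variable {m : ℕ}

open scoped MatrixOrder in
theorem sqrt_mul_self (A : PosDefMatrix m) : A.sqrt.1 * A.sqrt.1 = A.1 :=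
  CFC.sqrt_mul_sqrt_self A.1 A.2.posSemidef.nonneg

open scoped MatrixOrder in
theorem sqrt_eq_of_mul_self {A H : PosDefMatrix m} (h : H.1 * H.1 = A.1) : A.sqrt = H :=
  Subtype.ext (CFC.sqrt_unique h H.2.posSemidef.nonneg)

theorem transpose_eq (A : PosDefMatrix m) : A.1ᵀ = A.1 := by
  have := A.2.isHermitian.eq
  rwa [conjTranspose_eq_transpose_of_trivial] at this

theorem isUnit_det (A : PosDefMatrix m) : IsUnit A.1.det := A.2.det_pos.ne'.isUnit

theorem val_inv (A : PosDefMatrix m) : A.inv.1 = A.1⁻¹ := rfl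

theorem inv_mul_self (A : PosDefMatrix m) : A.inv.1 * A.1 = 1 := nonsing_inv_mul _ A.isUnit_det

theorem mul_inv_self (A : PosDefMatrix m) : A.1 * A.inv.1 = 1 := mul_nonsing_inv _ A.isUnit_det

theorem sqrt_one : (one m).sqrt = one m := sqrt_eq_of_mul_self (by simp [one])

theorem sqrt_inv_mul_sqrt_inv (A : PosDefMatrix m) : A.sqrt.inv.1 * A.sqrt.inv.1 = A.inv.1 := by
  rw [val_inv, val_inv, ← Matrix.mul_inv_rev, sqrt_mul_self]

theorem riemannianDist_eq (A B : PosDefMatrix m) :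
    A.riemannianDist B = √(logSq (A.inv.1 * B.1)) := by
  rw [riemannianDist, ← logSq_eq_sum_eigenvalues, mul_assoc, logSq_mul_comm, mul_assoc,
    sqrt_inv_mul_sqrt_inv, logSq_mul_comm]

theorem riemannianDist_one_left (B : PosDefMatrix m) :
    (one m).riemannianDist B = √(logSq B.1) := by
  rw [riemannianDist_eq]
  simp [inv, one]

theorem riemannianDist_one_right (A : PosDefMatrix m) :
    A.riemannianDist (one m) = (one m).riemannianDist A := by
  rw [riemannianDist_one_left, riemannianDist_eq]
  obtain ⟨U, a, hU, hU', ha, hA⟩ := A.2.exists_eq_conj_diagonal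
  have hinv : A.inv.1 = U * diagonal (fun i => (a i)⁻¹) * Uᵀ := by
    rw [val_inv, hA, inv_conj_diagonal hU fun i => (ha i).ne']
  rw [one, mul_one, hinv, hA, logSq_conj_diagonal hU, logSq_conj_diagonal hU]
  simp [Real.log_inv]

theorem riemannianDist_self (A : PosDefMatrix m) : A.riemannianDist A = 0 := by
  rw [riemannianDist_eq, inv_mul_self, ← diagonal_one, logSq_diagonal]
  simp

theorem riemannianDist_nonneg (A B : PosDefMatrix m) : 0 ≤ A.riemannianDist B :=
  Real.sqrt_nonneg _

theorem riemannianDist_triangle (A C B : PosDefMatrix m) :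
    A.riemannianDist B ≤ A.riemannianDist C + C.riemannianDist B := by
  have hP := posDef_mul_mul_self C.sqrt A.inv
  have hQ := posDef_mul_mul_self C.sqrt.inv B
  have h := sqrt_logSq_mul_le hP hQ
  have h1 : C.sqrt.1 * C.sqrt.inv.1 = 1 := mul_inv_self _
  have h2 : C.sqrt.inv.1 * C.sqrt.1 = 1 := inv_mul_self _
  have e1 : logSq (C.sqrt.1 * A.inv.1 * C.sqrt.1 * (C.sqrt.inv.1 * B.1 * C.sqrt.inv.1))
      = logSq (A.inv.1 * B.1) := by
    have : C.sqrt.1 * A.inv.1 * C.sqrt.1 * (C.sqrt.inv.1 * B.1 * C.sqrt.inv.1)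
        = C.sqrt.1 * A.inv.1 * (C.sqrt.1 * C.sqrt.inv.1) * B.1 * C.sqrt.inv.1 := by
      simp only [mul_assoc]
    rw [this, h1, mul_one, logSq_mul_comm]
    simp only [← mul_assoc]
    rw [h2, one_mul]
  have e2 : logSq (C.sqrt.1 * A.inv.1 * C.sqrt.1) = logSq (A.inv.1 * C.1) := by
    rw [mul_assoc, logSq_mul_comm, mul_assoc, sqrt_mul_self]
  have e3 : logSq (C.sqrt.inv.1 * B.1 * C.sqrt.inv.1) = logSq (C.inv.1 * B.1) := by
    rw [mul_assoc, logSq_mul_comm, mul_assoc, sqrt_inv_mul_sqrt_inv, logSq_mul_comm]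
  rwa [e1, e2, e3, ← riemannianDist_eq, ← riemannianDist_eq, ← riemannianDist_eq] at h

/-- `d_R` is invariant under the congruences `A ↦ g A gᵀ`; stated for the distance between `g gᵀ`
and `g B gᵀ`. -/
theorem riemannianDist_congr {A B C : PosDefMatrix m} {g : Matrix (Fin m) (Fin m) ℝ}
    (hA : A.1 = g * gᵀ) (hC : C.1 = g * B.1 * gᵀ) :
    A.riemannianDist C = (one m).riemannianDist B := by
  have hg : IsUnit g.det := by
    have := A.isUnit_det
    rw [hA, det_mul] at this
    exact isUnit_of_mul_isUnit_left this
  have hgt : IsUnit gᵀ.det := by rwa [det_transpose]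
  rw [riemannianDist_one_left, riemannianDist_eq]
  have : A.inv.1 * C.1 = gᵀ⁻¹ * (B.1 * gᵀ) := by
    rw [val_inv, hA, hC, Matrix.mul_inv_rev, mul_assoc, mul_assoc g,
      nonsing_inv_mul_cancel_left _ _ hg]
  rw [this, logSq_mul_comm, mul_assoc, mul_nonsing_inv _ hgt, mul_one]

theorem continuous_riemannianDist_one :
    Continuous fun A : PosDefMatrix m => (one m).riemannianDist A := by
  simp only [riemannianDist_one_left]
  exact continuous_logSq.sqrt

theorem continuous_inv : Continuous (inv : PosDefMatrix m → PosDefMatrix m) := by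
  refine Continuous.subtype_mk (f := fun A : PosDefMatrix m => A.1⁻¹) ?_ _
  have : (fun A : PosDefMatrix m => A.1⁻¹) = fun A => (A.1.det)⁻¹ • A.1.adjugate := by
    ext1 A
    rw [inv_def, Ring.inverse_eq_inv']
  rw [this]
  have hdet : Continuous fun A : PosDefMatrix m => (A.1.det)⁻¹ :=
    continuous_subtype_val.matrix_det.inv₀ fun A => A.2.det_pos.ne'
  exact hdet.smul continuous_subtype_val.matrix_adjugate

theorem sq_apply_le_trace_mul_self {E : Matrix (Fin m) (Fin m) ℝ} (hE : Eᵀ = E) (i j : Fin m) :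
    E i j ^ 2 ≤ trace (E * E) := by
  have h : trace (E * E) = ∑ i, ∑ j, E i j ^ 2 := by
    rw [trace]
    refine Finset.sum_congr rfl fun i _ => ?_
    rw [diag_apply, mul_apply]
    refine Finset.sum_congr rfl fun j _ => ?_
    nth_rewrite 2 [← hE]
    rw [transpose_apply, sq]
  rw [h]
  exact (Finset.single_le_sum (f := fun j => E i j ^ 2) (fun _ _ => sq_nonneg _)
    (Finset.mem_univ j)).trans (Finset.single_le_sum (f := fun i => ∑ j, E i j ^ 2)
    (fun _ _ => Finset.sum_nonneg fun _ _ => sq_nonneg _) (Finset.mem_univ i))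

/-- The square root is locally Lipschitz in the Frobenius norm, because
`(√x - √y)² ≤ (x - y)² / x`. -/
theorem exists_trace_sqrt_sub_le (A : PosDefMatrix m) : ∃ c : ℝ, ∀ B : PosDefMatrix m,
    trace ((B.sqrt.1 - A.sqrt.1) * (B.sqrt.1 - A.sqrt.1))
      ≤ c * trace ((B.1 - A.1) * (B.1 - A.1)) := by
  obtain ⟨U, a, hU, hU', ha, hA⟩ := A.2.exists_eq_conj_diagonal
  have hsqrt : ∀ (B : PosDefMatrix m) (V : Matrix (Fin m) (Fin m) ℝ) (b : Fin m → ℝ),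
      Vᵀ * V = 1 → (∀ i, 0 < b i) → B.1 = V * diagonal b * Vᵀ →
      B.sqrt.1 = V * diagonal (fun i => √(b i)) * Vᵀ := by
    intro B V b hV hb hB
    have hp := posDef_conj_diagonal (mul_eq_one_comm.mp hV) fun i => Real.sqrt_pos.mpr (hb i)
    refine congrArg Subtype.val (sqrt_eq_of_mul_self (H := ⟨_, hp⟩) ?_)
    have : V * diagonal (fun i => √(b i)) * Vᵀ * (V * diagonal (fun i => √(b i)) * Vᵀ)
      = V * (diagonal (fun i => √(b i)) * (Vᵀ * V) * diagonal (fun i => √(b i)) * Vᵀ) := by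
      simp only [mul_assoc]
    rw [hB, this, hV, mul_one, diagonal_mul_diagonal, mul_assoc]
    simp [Real.mul_self_sqrt (hb _).le]
  refine ⟨∑ i, (a i)⁻¹, fun B => ?_⟩
  obtain ⟨V, b, hV, -, hb, hB⟩ := B.2.exists_eq_conj_diagonal
  obtain ⟨w, hw0, hw₁, hw₂, hw⟩ := exists_doublyStochastic hU hV
  rw [hsqrt A U a hU ha hA, hsqrt B V b hV hb hB, hA, hB, trace_sub_mul_self hU hV hw₁ hw₂ (hw _ _),
    trace_sub_mul_self hU hV hw₁ hw₂ (hw _ _), Finset.mul_sum]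
  refine Finset.sum_le_sum fun i _ => ?_
  rw [Finset.mul_sum]
  refine Finset.sum_le_sum fun j _ => ?_
  rw [mul_left_comm]
  refine mul_le_mul_of_nonneg_left ?_ (hw0 i j)
  have h1 : (√(b j) - √(a i)) ^ 2 ≤ (a i)⁻¹ * (b j - a i) ^ 2 := by
    rw [← div_eq_inv_mul, le_div_iff₀ (ha i)]
    have e : b j - a i = (√(b j) - √(a i)) * (√(b j) + √(a i)) := by
      ring_nf
      rw [Real.sq_sqrt (hb j).le, Real.sq_sqrt (ha i).le]
    rw [e, mul_pow]
    refine mul_le_mul_of_nonneg_left ?_ (sq_nonneg _)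
    have := Real.sq_sqrt (ha i).le
    nlinarith [Real.sqrt_nonneg (b j), Real.sqrt_nonneg (a i),
      mul_nonneg (Real.sqrt_nonneg (b j)) (Real.sqrt_nonneg (a i))]
  refine h1.trans (mul_le_mul_of_nonneg_right ?_ (sq_nonneg _))
  exact Finset.single_le_sum (f := fun i => (a i)⁻¹) (fun i _ => (inv_pos.mpr (ha i)).le)
    (Finset.mem_univ i)

theorem continuous_sqrt : Continuous (sqrt : PosDefMatrix m → PosDefMatrix m) := by
  rw [continuous_induced_rng]
  refine continuous_matrix fun i j => continuous_iff_continuousAt.mpr fun A => ?_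
  obtain ⟨c, hc⟩ := exists_trace_sqrt_sub_le A
  have hquad : Tendsto (fun B : PosDefMatrix m => √(c * trace ((B.1 - A.1) * (B.1 - A.1))))
      (𝓝 A) (𝓝 0) := by
    have : Continuous fun B : PosDefMatrix m => √(c * trace ((B.1 - A.1) * (B.1 - A.1))) := by
      fun_prop
    simpa using this.tendsto A
  rw [ContinuousAt, tendsto_iff_dist_tendsto_zero]
  refine squeeze_zero (fun _ => dist_nonneg) (fun B => ?_) hquad
  rw [Real.dist_eq]
  refine Real.abs_le_sqrt (le_trans ?_ (hc B))
  exact sq_apply_le_trace_mul_self (E := B.sqrt.1 - A.sqrt.1)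
    (by rw [transpose_sub, transpose_eq, transpose_eq]) i j

end PosDefMatrix

/-! ### First passages of a walk with independent increments -/

section RealSums

theorem add_pow_succ_ge {b B : ℝ} (hb : 0 ≤ b) (hB : 0 ≤ B) (r : ℕ) :
    (r + 1) * (b * B ^ r) + B ^ (r + 1) ≤ (b + B) ^ (r + 1) := by
  induction r with
  | zero => simp
  | succ r ih =>
    have h1 : (b + B) * ((r + 1) * (b * B ^ r) + B ^ (r + 1)) ≤ (b + B) ^ (r + 1 + 1) := by
      rw [pow_succ' (b + B) (r + 1)]
      exact mul_le_mul_of_nonneg_left ih (by positivity)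
    have h2 : 0 ≤ (r + 1) * (b ^ 2 * B ^ r) := by positivity
    push_cast
    calc _ = (b + B) * ((r + 1) * (b * B ^ r) + B ^ (r + 1)) - (r + 1) * (b ^ 2 * B ^ r) := by ring
      _ ≤ _ := by linarith

theorem sum_Ioc_eq_add_of_lt (b : ℕ → ℝ) {j n : ℕ} (h : j < n) :
    ∑ i ∈ Finset.Ioc j n, b i = b (j + 1) + ∑ i ∈ Finset.Ioc (j + 1) n, b i := by
  rw [← Finset.sum_Ioc_consecutive b (Nat.le_succ j) h]
  simp

/-- The discrete form of `∫ b B^r = B^(r+1) / (r+1)` for the tail sums `B` of `b ≥ 0`. -/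
theorem sum_mul_tail_pow_le {b : ℕ → ℝ} (hb : ∀ i, 0 ≤ b i) (r j n : ℕ) :
    ∑ k ∈ Finset.Ioc j n, b k * (∑ i ∈ Finset.Ioc k n, b i) ^ r
      ≤ (∑ i ∈ Finset.Ioc j n, b i) ^ (r + 1) / (r + 1) := by
  induction h : n - j generalizing j with
  | zero => simp [Finset.Ioc_eq_empty_of_le (Nat.sub_eq_zero_iff_le.mp h)]
  | succ d ih =>
    have hlt : j < n := by omega
    rw [sum_Ioc_eq_add_of_lt _ hlt, sum_Ioc_eq_add_of_lt b hlt]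
    have hB : 0 ≤ ∑ i ∈ Finset.Ioc (j + 1) n, b i := Finset.sum_nonneg fun i _ => hb i
    have h1 := ih (j + 1) (by omega)
    have h2 := add_pow_succ_ge (hb (j + 1)) hB r
    have hr : (0 : ℝ) < r + 1 := by positivity
    rw [le_div_iff₀ hr] at h1 ⊢
    linarith

/-- Abel summation: if the partial sums of `p` are dominated by those of `b`, the same holds after
weighting by a nonnegative nonincreasing `g`. -/
theorem sum_mul_le_sum_mul_of_partial_sums {p b g : ℕ → ℝ} (hg : Antitone g) (hg0 : ∀ i, 0 ≤ g i)
    {j n : ℕ}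
    (h : ∀ k ≤ n, ∑ i ∈ Finset.Ioc j k, p i ≤ ∑ i ∈ Finset.Ioc j k, b i) :
    ∑ i ∈ Finset.Ioc j n, p i * g i ≤ ∑ i ∈ Finset.Ioc j n, b i * g i := by
  suffices H : ∀ k ≤ n, g k * ∑ i ∈ Finset.Ioc j k, (b i - p i)
      ≤ ∑ i ∈ Finset.Ioc j k, (b i - p i) * g i by
    have h1 := H n le_rfl
    have h2 : 0 ≤ g n * ∑ i ∈ Finset.Ioc j n, (b i - p i) := by
      refine mul_nonneg (hg0 n) ?_
      rw [Finset.sum_sub_distrib]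
      linarith [h n le_rfl]
    simp only [sub_mul, Finset.sum_sub_distrib] at h1 h2
    linarith
  intro k
  induction k with
  | zero => simp
  | succ k ih =>
    intro hk
    rcases Nat.lt_or_ge k j with hkj | hkj
    · simp [Finset.Ioc_eq_empty_of_le (Nat.succ_le_of_lt hkj)]
    · rw [Finset.sum_Ioc_succ_top hkj, Finset.sum_Ioc_succ_top hkj, mul_add]
      have h1 := ih (by omega)
      have h2 : 0 ≤ ∑ i ∈ Finset.Ioc j k, (b i - p i) := by
        rw [Finset.sum_sub_distrib]
        linarith [h k (by omega)]
      have h3 := mul_le_mul_of_nonneg_right (hg (Nat.le_succ k)) h2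
      linarith [mul_comm (g (k + 1)) (b (k + 1) - p (k + 1))]

end RealSums

section IncrementArray

variable {Ω : Type*}

theorem iSup_Ico_mono {α : Type*} [CompleteLattice α] (f : ℕ → α) {j k j' k' : ℕ} (hj : j' ≤ j)
    (hk : k ≤ k') : ⨆ i ∈ Set.Ico j k, f i ≤ ⨆ i ∈ Set.Ico j' k', f i :=
  biSup_mono fun _ hi => ⟨hj.trans hi.1, hi.2.trans_le hk⟩

/-- The event that `k` is the first index after `j` with `D j k > s`. -/
def firstHit (D : ℕ → ℕ → Ω → ℝ) (s : ℝ) (j k : ℕ) : Set Ω :=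
  {ω | s < D j k ω ∧ ∀ i, j < i → i < k → D j i ω ≤ s}

/-- The event that `D j i > s` for some index `i` with `j < i ≤ k`. -/
def exceeds (D : ℕ → ℕ → Ω → ℝ) (s : ℝ) (j k : ℕ) : Set Ω :=
  {ω | ∃ i ∈ Finset.Ioc j k, s < D j i ω}

/-- The event that, starting from `j`, the successive first passages over the thresholds in the
list (the walk being restarted at each of them) are all completed by time `n`. -/
def passageChain (D : ℕ → ℕ → Ω → ℝ) (n : ℕ) : List ℝ → ℕ → Set Ω
  | [], _ => Set.univ
  | s :: L, j => ⋃ k ∈ Finset.Ioc j n, firstHit D s j k ∩ passageChain D n L k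

/-- The distances `D j k = d(S_j, S_k)`, `j ≤ k`, between the positions of a random walk in a
metric space for which `D j k` only involves the steps numbered `j, …, k - 1`; the step numbered
`i` generates the σ-algebra `𝓕 i`. Symmetry of the metric only enters through the second form of
the triangle inequality, with the middle point `S_0`. -/
structure IsIncrementArray [mΩ : MeasurableSpace Ω] (P : Measure Ω) (𝓕 : ℕ → MeasurableSpace Ω)
    (D : ℕ → ℕ → Ω → ℝ) : Prop where
  le : ∀ i, 𝓕 i ≤ mΩ
  iIndep : iIndep 𝓕 P
  measurable : ∀ {j k}, j ≤ k → Measurable[⨆ i ∈ Set.Ico j k, 𝓕 i] (D j k)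
  self : ∀ j ω, D j j ω = 0
  triangle : ∀ {i j k}, i ≤ j → j ≤ k → ∀ ω, D i k ω ≤ D i j ω + D j k ω
  triangle_zero : ∀ {j k}, j ≤ k → ∀ ω, D j k ω ≤ D 0 j ω + D 0 k ω

variable {D : ℕ → ℕ → Ω → ℝ}

theorem exceeds_eq_biUnion (s : ℝ) (j k : ℕ) :
    exceeds D s j k = ⋃ i ∈ Finset.Ioc j k, firstHit D s j i := by
  ext ω
  simp only [exceeds, Set.mem_ofPred_eq, Set.mem_iUnion, exists_prop]
  constructor
  · intro h
    classical
    obtain ⟨hi, hs⟩ := Nat.find_spec h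
    refine ⟨Nat.find h, hi, hs, fun i hji hik => ?_⟩
    by_contra! hlt
    exact Nat.find_min h hik ⟨Finset.mem_Ioc.mpr ⟨hji, hik.le.trans (Finset.mem_Ioc.mp hi).2⟩, hlt⟩
  · rintro ⟨i, hi, hs, -⟩
    exact ⟨i, hi, hs⟩

theorem disjoint_firstHit (s : ℝ) (j : ℕ) {i k : ℕ} (hi : j < i) (hik : i < k) :
    Disjoint (firstHit D s j i) (firstHit D s j k) := by
  rw [Set.disjoint_left]
  rintro ω ⟨h1, -⟩ ⟨-, h2⟩
  exact absurd h1 (h2 i hi hik).not_gt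

variable [mΩ : MeasurableSpace Ω] {P : Measure Ω}
  {𝓕 : ℕ → MeasurableSpace Ω}

namespace IsIncrementArray

/-- The pathwise core of the argument: if the chain of passages is not completed, the walk is
controlled by the thresholds, plus one step for each passage that did occur. -/
theorem exists_le_sum_of_notMem_passageChain (hD : IsIncrementArray P 𝓕 D) {n : ℕ} {ω : Ω}
    (L : List ℝ) (j : ℕ)
    (hL : ∀ s ∈ L, 0 ≤ s) (hω : ω ∉ passageChain D n L j) {k : ℕ} (hjk : j ≤ k) (hkn : k ≤ n) :
    ∃ J ⊆ Finset.Ico j n, J.card + 1 ≤ L.length ∧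
      D j k ω ≤ L.sum + ∑ i ∈ J, D i (i + 1) ω := by
  classical
  induction L generalizing j with
  | nil => exact absurd (Set.mem_univ ω) hω
  | cons s L ih =>
    have hs : 0 ≤ s := hL s List.mem_cons_self
    have hL' : ∀ s ∈ L, 0 ≤ s := fun x hx => hL x (List.mem_cons_of_mem _ hx)
    by_cases h : ω ∈ exceeds D s j k
    · rw [exceeds_eq_biUnion] at h
      simp only [Set.mem_iUnion, exists_prop, Finset.mem_Ioc] at h
      obtain ⟨i, ⟨hji, hik⟩, hit⟩ := h
      obtain ⟨p, rfl⟩ : ∃ p, i = p + 1 := ⟨i - 1, by omega⟩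
      have hnot : ω ∉ passageChain D n L (p + 1) := fun hc => hω <| by
        simp only [passageChain, Set.mem_iUnion, exists_prop, Finset.mem_Ioc]
        exact ⟨p + 1, ⟨hji, hik.trans hkn⟩, hit, hc⟩
      obtain ⟨J, hJ, hcard, hle⟩ := ih (p + 1) hL' hnot hik
      have hpJ : p ∉ J := fun hp => by
        have := Finset.mem_Ico.mp (hJ hp)
        omega
      refine ⟨insert p J, ?_, ?_, ?_⟩
      · rw [Finset.insert_subset_iff]
        refine ⟨Finset.mem_Ico.mpr ⟨by omega, by omega⟩, hJ.trans ?_⟩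
        exact Finset.Ico_subset_Ico_left (by omega)
      · rw [Finset.card_insert_of_notMem hpJ, List.length_cons]
        omega
      · rw [Finset.sum_insert hpJ, List.sum_cons]
        have hp : D j p ω ≤ s := by
          rcases (Nat.lt_succ_iff.mp hji).eq_or_lt with rfl | hlt
          · rw [hD.self]; exact hs
          · exact hit.2 p hlt (Nat.lt_succ_self p)
        have h1 := hD.triangle hji.le hik ω
        have h2 := hD.triangle (Nat.lt_succ_iff.mp hji) (Nat.le_succ p) ω
        linarith
    · refine ⟨∅, Finset.empty_subset _, by simp, ?_⟩
      have hLs : 0 ≤ L.sum := List.sum_nonneg hL'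
      rw [Finset.sum_empty, List.sum_cons, add_zero]
      rcases hjk.eq_or_lt with rfl | hlt
      · rw [hD.self]; linarith
      · have : D j k ω ≤ s := by
          by_contra! hc
          exact h ⟨k, Finset.mem_Ioc.mpr ⟨hlt, le_rfl⟩, hc⟩
        linarith

theorem iSup_le (hD : IsIncrementArray P 𝓕 D) (j k : ℕ) : ⨆ i ∈ Set.Ico j k, 𝓕 i ≤ mΩ :=
  iSup₂_le fun i _ => hD.le i

theorem real_inter (hD : IsIncrementArray P 𝓕 D) {j k n : ℕ} {A B : Set Ω}
    (hA : MeasurableSet[⨆ i ∈ Set.Ico j k, 𝓕 i] A) (hB : MeasurableSet[⨆ i ∈ Set.Ico k n, 𝓕 i] B) :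
    P.real (A ∩ B) = P.real A * P.real B := by
  have h := indep_iSup_of_disjoint hD.le hD.iIndep (S := Set.Ico j k) (T := Set.Ico k n)
    (Set.disjoint_left.mpr fun i h1 h2 => (h1.2.trans_le h2.1).false)
  rw [measureReal_def, (Indep_iff _ _ _).mp h A B hA hB, ENNReal.toReal_mul]
  rfl

theorem measurableSet_lt (hD : IsIncrementArray P 𝓕 D) (s : ℝ) {j i k : ℕ} (hji : j ≤ i)
    (hik : i ≤ k) : MeasurableSet[⨆ i ∈ Set.Ico j k, 𝓕 i] {ω | s < D j i ω} :=
  iSup_Ico_mono 𝓕 le_rfl hik _ (hD.measurable hji measurableSet_Ioi)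

theorem measurableSet_firstHit (hD : IsIncrementArray P 𝓕 D) (s : ℝ) {j k : ℕ} (hjk : j ≤ k) :
    MeasurableSet[⨆ i ∈ Set.Ico j k, 𝓕 i] (firstHit D s j k) := by
  have h : firstHit D s j k = {ω | s < D j k ω} ∩
      ⋂ i ∈ Finset.Ioo j k, {ω | s < D j i ω}ᶜ := by
    ext ω
    simp [firstHit]
  rw [h]
  refine MeasurableSet.inter (hD.measurableSet_lt s hjk le_rfl) ?_
  refine Finset.measurableSet_biInter _ fun i hi => ?_
  rw [Finset.mem_Ioo] at hi
  exact (hD.measurableSet_lt s hi.1.le hi.2.le).compl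

theorem measurableSet_exceeds (hD : IsIncrementArray P 𝓕 D) (s : ℝ) (j k : ℕ) :
    MeasurableSet[⨆ i ∈ Set.Ico j k, 𝓕 i] (exceeds D s j k) := by
  rw [exceeds_eq_biUnion]
  refine Finset.measurableSet_biUnion _ fun i hi => ?_
  rw [Finset.mem_Ioc] at hi
  exact iSup_Ico_mono 𝓕 le_rfl hi.2 _ (hD.measurableSet_firstHit s hi.1.le)

theorem measurableSet_passageChain (hD : IsIncrementArray P 𝓕 D) (n : ℕ) (L : List ℝ) (j : ℕ) :
    MeasurableSet[⨆ i ∈ Set.Ico j n, 𝓕 i] (passageChain D n L j) := by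
  induction L generalizing j with
  | nil => exact MeasurableSet.univ
  | cons s L ih =>
    refine Finset.measurableSet_biUnion _ fun k hk => ?_
    rw [Finset.mem_Ioc] at hk
    exact MeasurableSet.inter
      (iSup_Ico_mono 𝓕 le_rfl hk.2 _ (hD.measurableSet_firstHit s hk.1.le))
      (iSup_Ico_mono 𝓕 hk.1.le le_rfl _ (ih k))

theorem sum_real_firstHit [IsProbabilityMeasure P] (hD : IsIncrementArray P 𝓕 D) (s : ℝ)
    (j k : ℕ) : ∑ i ∈ Finset.Ioc j k, P.real (firstHit D s j i) = P.real (exceeds D s j k) := by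
  rw [exceeds_eq_biUnion, measureReal_biUnion_finset]
  · intro i hi i' hi' hne
    rw [Finset.mem_coe, Finset.mem_Ioc] at hi hi'
    rcases lt_or_gt_of_ne hne with h | h
    · exact disjoint_firstHit s j hi.1 h
    · exact (disjoint_firstHit s j hi'.1 h).symm
  · intro i hi
    exact hD.iSup_le _ _ _ (hD.measurableSet_firstHit s (Finset.mem_Ioc.mp hi).1.le)

theorem real_passageChain_cons_le [IsProbabilityMeasure P] (hD : IsIncrementArray P 𝓕 D)
    (n : ℕ) (s : ℝ) (L : List ℝ) (j : ℕ) :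
    P.real (passageChain D n (s :: L) j)
      ≤ ∑ k ∈ Finset.Ioc j n, P.real (firstHit D s j k) * P.real (passageChain D n L k) := by
  refine (measureReal_biUnion_finset_le _ _).trans (Finset.sum_le_sum fun k hk => ?_)
  exact (hD.real_inter (hD.measurableSet_firstHit s (Finset.mem_Ioc.mp hk).1.le)
    (hD.measurableSet_passageChain n L k)).le

theorem exceeds_two_mul_subset (hD : IsIncrementArray P 𝓕 D) {t : ℝ} (ht : 0 ≤ t) (j n : ℕ) :
    exceeds D (2 * t) j n ⊆ exceeds D t 0 n := by
  rintro ω ⟨i, hi, hlt⟩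
  rw [Finset.mem_Ioc] at hi
  by_cases h : t < D 0 i ω
  · exact ⟨i, Finset.mem_Ioc.mpr ⟨by omega, hi.2⟩, h⟩
  · have h2 := hD.triangle_zero hi.1.le ω
    have hj : t < D 0 j ω := by linarith [not_lt.mp h]
    rcases Nat.eq_zero_or_pos j with rfl | hpos
    · rw [hD.self] at hj
      exact absurd hj ht.not_gt
    · exact ⟨j, Finset.mem_Ioc.mpr ⟨hpos, hi.1.le.trans hi.2⟩, hj⟩

/-- If the walk stays within distance `t` of the origin up to time `j` and then moves further than
`2t` away from its position at time `j`, it leaves the `t`-ball in between. By independence, the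
restarted first-passage law at level `2t` is dominated, up to the factor `P(U_n ≤ t)`, by the
first-passage law at level `t` of the walk itself. -/
theorem real_compl_exceeds_mul_le [IsProbabilityMeasure P] (hD : IsIncrementArray P 𝓕 D)
    {t : ℝ} (ht : 0 ≤ t) (j : ℕ) {k n : ℕ} (hkn : k ≤ n) :
    P.real (exceeds D t 0 n)ᶜ * ∑ i ∈ Finset.Ioc j k, P.real (firstHit D (2 * t) j i)
      ≤ ∑ i ∈ Finset.Ioc j k, P.real (firstHit D t 0 i) := by
  rcases Nat.lt_or_ge j k with hjk | hjk
  swap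
  · simp [Finset.Ioc_eq_empty_of_le hjk]
  rw [hD.sum_real_firstHit]
  have hsub : (exceeds D t 0 n)ᶜ ⊆ (exceeds D t 0 j)ᶜ := by
    refine Set.compl_subset_compl.mpr ?_
    rintro ω ⟨i, hi, hlt⟩
    rw [Finset.mem_Ioc] at hi
    exact ⟨i, Finset.mem_Ioc.mpr ⟨hi.1, by omega⟩, hlt⟩
  calc P.real (exceeds D t 0 n)ᶜ * P.real (exceeds D (2 * t) j k)
      ≤ P.real (exceeds D t 0 j)ᶜ * P.real (exceeds D (2 * t) j k) := by
        exact mul_le_mul_of_nonneg_right (measureReal_mono hsub (measure_ne_top _ _))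
          measureReal_nonneg
    _ = P.real ((exceeds D t 0 j)ᶜ ∩ exceeds D (2 * t) j k) :=
        (hD.real_inter (hD.measurableSet_exceeds t 0 j).compl
          (hD.measurableSet_exceeds (2 * t) j k)).symm
    _ ≤ P.real (⋃ i ∈ Finset.Ioc j k, firstHit D t 0 i) := by
        refine measureReal_mono ?_ (measure_ne_top _ _)
        rintro ω ⟨h1, h2⟩
        have h3 := hD.exceeds_two_mul_subset ht j k h2
        rw [exceeds_eq_biUnion] at h3
        simp only [Set.mem_iUnion, exists_prop, Finset.mem_Ioc] at h3 ⊢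
        obtain ⟨i, hi, hit⟩ := h3
        refine ⟨i, ⟨?_, hi.2⟩, hit⟩
        by_contra! hij
        exact h1 ⟨i, Finset.mem_Ioc.mpr ⟨hi.1, hij⟩, hit.1⟩
    _ ≤ _ := measureReal_biUnion_finset_le _ _

/-- Each passage has conditional probability at most `P(U_n > t)`. -/
theorem real_passageChain_replicate_le_pow [IsProbabilityMeasure P] (hD : IsIncrementArray P 𝓕 D)
    {t : ℝ} (ht : 0 ≤ t) {n : ℕ} {L : List ℝ} {C : ℝ} (hC : 0 ≤ C)
    (hL : ∀ j, P.real (passageChain D n L j) ≤ C) (r j : ℕ) :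
    P.real (passageChain D n (List.replicate r (2 * t) ++ L) j)
      ≤ P.real (exceeds D t 0 n) ^ r * C := by
  induction r generalizing j with
  | zero => simpa using hL j
  | succ r ih =>
    refine (hD.real_passageChain_cons_le n _ _ j).trans ?_
    calc _ ≤ ∑ k ∈ Finset.Ioc j n, P.real (firstHit D (2 * t) j k) *
          (P.real (exceeds D t 0 n) ^ r * C) := by
          gcongr with k hk
          exact ih k
      _ = P.real (exceeds D (2 * t) j n) * (P.real (exceeds D t 0 n) ^ r * C) := by
          rw [← Finset.sum_mul, hD.sum_real_firstHit]
      _ ≤ P.real (exceeds D t 0 n) * (P.real (exceeds D t 0 n) ^ r * C) := by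
          exact mul_le_mul_of_nonneg_right (measureReal_mono (hD.exceeds_two_mul_subset ht j n)
            (measure_ne_top _ _)) (by positivity)
      _ = _ := by ring

/-- The improvement by `1 / r!` comes from the ordering of the `r` passage times: after the
domination of `real_compl_exceeds_mul_le`, the bound is an iterated sum over increasing
`r`-tuples. -/
theorem real_passageChain_replicate_le_pow_div_factorial [IsProbabilityMeasure P]
    (hD : IsIncrementArray P 𝓕 D)
    {t : ℝ} (ht : 0 ≤ t) {n : ℕ} {L : List ℝ} {C : ℝ} (hC : 0 ≤ C)
    (hL : ∀ j, P.real (passageChain D n L j) ≤ C) (hq : 0 < P.real (exceeds D t 0 n)ᶜ) (r j : ℕ) :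
    P.real (passageChain D n (List.replicate r (2 * t) ++ L) j)
      ≤ (∑ i ∈ Finset.Ioc j n, P.real (firstHit D t 0 i) / P.real (exceeds D t 0 n)ᶜ) ^ r
        / r.factorial * C := by
  set b : ℕ → ℝ := fun i => P.real (firstHit D t 0 i) / P.real (exceeds D t 0 n)ᶜ with hb
  have hb0 : ∀ i, 0 ≤ b i := fun i => by positivity
  induction r generalizing j with
  | zero => simpa using hL j
  | succ r ih =>
    have hanti : Antitone fun k => (∑ i ∈ Finset.Ioc k n, b i) ^ r / r.factorial * C := by
      intro k k' hkk'
      have h1 : 0 ≤ ∑ i ∈ Finset.Ioc k' n, b i := Finset.sum_nonneg fun i _ => hb0 i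
      have h2 : ∑ i ∈ Finset.Ioc k' n, b i ≤ ∑ i ∈ Finset.Ioc k n, b i :=
        Finset.sum_le_sum_of_subset_of_nonneg (Finset.Ioc_subset_Ioc_left hkk')
          fun i _ _ => hb0 i
      dsimp only
      gcongr
    have hnn : ∀ k, 0 ≤ (∑ i ∈ Finset.Ioc k n, b i) ^ r / r.factorial * C := fun k => by
      have : 0 ≤ ∑ i ∈ Finset.Ioc k n, b i := Finset.sum_nonneg fun i _ => hb0 i
      positivity
    refine (hD.real_passageChain_cons_le n _ _ j).trans ?_
    calc _ ≤ ∑ k ∈ Finset.Ioc j n, P.real (firstHit D (2 * t) j k) *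
          ((∑ i ∈ Finset.Ioc k n, b i) ^ r / r.factorial * C) := by
          gcongr with k hk
          exact ih k
      _ ≤ ∑ k ∈ Finset.Ioc j n, b k * ((∑ i ∈ Finset.Ioc k n, b i) ^ r / r.factorial * C) := by
          refine sum_mul_le_sum_mul_of_partial_sums hanti hnn fun k hk => ?_
          rw [hb, ← Finset.sum_div, le_div_iff₀ hq, mul_comm]
          exact hD.real_compl_exceeds_mul_le ht j hk
      _ = (∑ k ∈ Finset.Ioc j n, b k * (∑ i ∈ Finset.Ioc k n, b i) ^ r) * (C / r.factorial) := by
          rw [Finset.sum_mul]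
          refine Finset.sum_congr rfl fun k _ => ?_
          ring
      _ ≤ ((∑ i ∈ Finset.Ioc j n, b i) ^ (r + 1) / (r + 1)) * (C / r.factorial) := by
          gcongr
          exact sum_mul_tail_pow_le hb0 r j n
      _ = _ := by
          rw [Nat.factorial_succ]
          push_cast
          field_simp

theorem real_passageChain_first_le_pow [IsProbabilityMeasure P] (hD : IsIncrementArray P 𝓕 D)
    {t : ℝ} (ht : 0 ≤ t) {n : ℕ} {L : List ℝ} {C : ℝ} (hC : 0 ≤ C)
    (hL : ∀ j, P.real (passageChain D n L j) ≤ C) (r : ℕ) :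
    P.real (passageChain D n (t :: (List.replicate r (2 * t) ++ L)) 0)
      ≤ P.real (exceeds D t 0 n) ^ (r + 1) * C := by
  refine (hD.real_passageChain_cons_le n _ _ 0).trans ?_
  calc _ ≤ ∑ k ∈ Finset.Ioc 0 n, P.real (firstHit D t 0 k) *
        (P.real (exceeds D t 0 n) ^ r * C) := by
        gcongr with k hk
        exact hD.real_passageChain_replicate_le_pow ht hC hL r k
    _ = _ := by
        rw [← Finset.sum_mul, hD.sum_real_firstHit]
        ring

/-- The first passage starts at the origin, so that it is at level `t` rather than `2t` and saves a
factor `P(U_n ≤ t)`. -/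
theorem real_passageChain_first_le_pow_div_factorial [IsProbabilityMeasure P]
    (hD : IsIncrementArray P 𝓕 D)
    {t : ℝ} (ht : 0 ≤ t) {n : ℕ} {L : List ℝ} {C : ℝ} (hC : 0 ≤ C)
    (hL : ∀ j, P.real (passageChain D n L j) ≤ C) (hq : 0 < P.real (exceeds D t 0 n)ᶜ) (r : ℕ) :
    P.real (passageChain D n (t :: (List.replicate r (2 * t) ++ L)) 0)
      ≤ P.real (exceeds D t 0 n)ᶜ * (1 / (r + 1).factorial *
        (P.real (exceeds D t 0 n) / P.real (exceeds D t 0 n)ᶜ) ^ (r + 1) * C) := by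
  set b : ℕ → ℝ := fun i => P.real (firstHit D t 0 i) / P.real (exceeds D t 0 n)ᶜ with hb
  have hb0 : ∀ i, 0 ≤ b i := fun i => by positivity
  refine (hD.real_passageChain_cons_le n _ _ 0).trans ?_
  calc _ ≤ ∑ k ∈ Finset.Ioc 0 n, P.real (firstHit D t 0 k) *
        ((∑ i ∈ Finset.Ioc k n, b i) ^ r / r.factorial * C) := by
        gcongr with k hk
        exact hD.real_passageChain_replicate_le_pow_div_factorial ht hC hL hq r k
    _ = (∑ k ∈ Finset.Ioc 0 n, b k * (∑ i ∈ Finset.Ioc k n, b i) ^ r) *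
          (P.real (exceeds D t 0 n)ᶜ * (C / r.factorial)) := by
        rw [Finset.sum_mul]
        refine Finset.sum_congr rfl fun k _ => ?_
        rw [hb]
        field_simp
    _ ≤ ((∑ i ∈ Finset.Ioc 0 n, b i) ^ (r + 1) / (r + 1)) *
          (P.real (exceeds D t 0 n)ᶜ * (C / r.factorial)) := by
        gcongr
        exact sum_mul_tail_pow_le hb0 r 0 n
    _ = _ := by
        rw [hb, ← Finset.sum_div, hD.sum_real_firstHit, Nat.factorial_succ]
        push_cast
        field_simp

end IsIncrementArray
end IncrementArray

/-! ### The list of thresholds -/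

section Blocks

/-- For each `j = 2, …, i + 1`, the threshold `2 t_j` repeated `ν_j` times. -/
def laterThresholds (ν : ℕ → ℕ) (t : ℕ → ℝ) : ℕ → List ℝ
  | 0 => []
  | i + 1 => List.replicate (ν (i + 2)) (2 * t (i + 2)) ++ laterThresholds ν t i

/-- The `n_1 + ⋯ + n_l` thresholds of the argument: `t_1` once, then `2 t_1` repeated `n_1 - 1`
times, then `2 t_j` repeated `n_j` times for `2 ≤ j ≤ l`. -/
def thresholds (ν : ℕ → ℕ) (t : ℕ → ℝ) (l : ℕ) : List ℝ :=
  t 1 :: (List.replicate (ν 1 - 1) (2 * t 1) ++ laterThresholds ν t (l - 1))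

theorem length_laterThresholds (ν : ℕ → ℕ) (t : ℕ → ℝ) (i : ℕ) :
    (laterThresholds ν t i).length = ∑ j ∈ Finset.Icc 2 (i + 1), ν j := by
  induction i with
  | zero => simp [laterThresholds]
  | succ i ih =>
    rw [laterThresholds, List.length_append, List.length_replicate, ih,
      Finset.sum_Icc_succ_top (by omega : 2 ≤ i + 1 + 1), add_comm]

theorem sum_laterThresholds (ν : ℕ → ℕ) (t : ℕ → ℝ) (i : ℕ) :
    (laterThresholds ν t i).sum = 2 * ∑ j ∈ Finset.Icc 2 (i + 1), (ν j : ℝ) * t j := by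
  induction i with
  | zero => simp [laterThresholds]
  | succ i ih =>
    rw [laterThresholds, List.sum_append, List.sum_replicate, ih,
      Finset.sum_Icc_succ_top (by omega : 2 ≤ i + 1 + 1), nsmul_eq_mul]
    ring

theorem nonneg_of_mem_laterThresholds {ν : ℕ → ℕ} {t : ℕ → ℝ} (i : ℕ)
    (ht : ∀ j ≤ i + 1, 0 ≤ t j) : ∀ s ∈ laterThresholds ν t i, 0 ≤ s := by
  induction i with
  | zero => simp [laterThresholds]
  | succ i ih =>
    intro s hs
    rw [laterThresholds, List.mem_append] at hs
    rcases hs with hs | hs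
    · rw [List.eq_of_mem_replicate hs]
      exact mul_nonneg zero_le_two (ht _ le_rfl)
    · exact ih (fun j hj => ht j (by omega)) s hs

theorem Finset.Icc_one_eq_insert {l : ℕ} (hl : 1 ≤ l) :
    Finset.Icc 1 l = insert 1 (Finset.Icc 2 l) := by
  ext j
  simp only [Finset.mem_insert, Finset.mem_Icc]
  omega

variable {ν : ℕ → ℕ} {t : ℕ → ℝ} {l : ℕ}

theorem length_thresholds (hl : 1 ≤ l) (hν : 1 ≤ ν 1) :
    (thresholds ν t l).length = ∑ j ∈ Finset.Icc 1 l, ν j := by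
  rw [thresholds, List.length_cons, List.length_append, List.length_replicate,
    length_laterThresholds, Nat.sub_add_cancel hl, Finset.Icc_one_eq_insert hl,
    Finset.sum_insert (by simp)]
  omega

theorem sum_thresholds (hl : 1 ≤ l) (hν : 1 ≤ ν 1) :
    (thresholds ν t l).sum
      = (2 * (ν 1 : ℝ) - 1) * t 1 + 2 * ∑ j ∈ Finset.Icc 2 l, (ν j : ℝ) * t j := by
  rw [thresholds, List.sum_cons, List.sum_append, List.sum_replicate, sum_laterThresholds,
    Nat.sub_add_cancel hl, nsmul_eq_mul, Nat.cast_sub hν]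
  push_cast
  ring

theorem nonneg_of_mem_thresholds (hl : 1 ≤ l) (ht : ∀ j ≤ l, 0 ≤ t j) :
    ∀ s ∈ thresholds ν t l, 0 ≤ s := by
  intro s hs
  rw [thresholds, List.mem_cons, List.mem_append] at hs
  rcases hs with rfl | hs | hs
  · exact ht 1 hl
  · rw [List.eq_of_mem_replicate hs]
    exact mul_nonneg zero_le_two (ht 1 hl)
  · exact nonneg_of_mem_laterThresholds (l - 1) (fun j hj => ht j (by omega)) s hs

/-- The factor contributed by the index `j` to `hjProduct`. -/
noncomputable def blockFactor {Ω : Type*} [MeasurableSpace Ω] (P : Measure Ω) (U : Ω → ℝ)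
    (l : ℕ) (ν : ℕ → ℕ) (t : ℕ → ℝ) (j : ℕ) : ℝ :=
  if j ∈ indexSet P U l ν t then P.real {ω | t j < U ω} ^ ν j
  else 1 / ((ν j).factorial : ℝ) * (P.real {ω | t j < U ω} / P.real {ω | U ω ≤ t j}) ^ ν j

variable {Ω : Type*} [mΩ : MeasurableSpace Ω] {P : Measure Ω} {U : Ω → ℝ}

theorem blockFactor_nonneg (j : ℕ) : 0 ≤ blockFactor P U l ν t j := by
  rw [blockFactor]
  split_ifs <;> positivity

theorem hjProduct_eq (hl : 1 ≤ l) :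
    hjProduct P U l ν t = P.real {ω | U ω ≤ t 1} ^ (if 1 ∉ indexSet P U l ν t then 1 else 0) *
      (blockFactor P U l ν t 1 * ∏ j ∈ Finset.Icc 2 l, blockFactor P U l ν t j) := by
  classical
  have hsub : indexSet P U l ν t ⊆ Finset.Icc 1 l := Finset.filter_subset _ _
  rw [← Finset.prod_insert (by simp), ← Finset.Icc_one_eq_insert hl,
    ← Finset.prod_sdiff hsub, hjProduct, mul_assoc, mul_comm (∏ j ∈ indexSet P U l ν t, _)]
  congr 2
  · refine Finset.prod_congr ?_ fun j hj => ?_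
    · congr
    · rw [blockFactor, if_neg (Finset.mem_sdiff.mp hj).2]
  · refine Finset.prod_congr rfl fun j hj => ?_
    rw [blockFactor, if_pos hj]

/-- Outside the index set `I_0` the probability `P(U ≤ t_j)` does not vanish: for `j = 1`, `ν_1 = 1`
the exponent is `0` and the defining inequality holds. -/
theorem real_le_pos_of_notMem_indexSet (hν : ∀ j ∈ Finset.Icc 1 l, 1 ≤ ν j) {j : ℕ}
    (hj : j ∈ Finset.Icc 1 l) (hn : j ∉ indexSet P U l ν t) : 0 < P.real {ω | U ω ≤ t j} := by
  refine measureReal_nonneg.lt_of_ne fun h0 => hn ?_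
  rw [indexSet, Finset.mem_filter]
  refine ⟨hj, ?_⟩
  rw [← h0]
  rcases Nat.eq_zero_or_pos (ν j - if j = 1 then 1 else 0) with he | he
  · have h1 : ν j = 1 := by
      have := hν j hj
      split_ifs at he <;> omega
    rw [he, h1]
    simp
  · rw [zero_pow he.ne']
    positivity

variable {𝓕 : ℕ → MeasurableSpace Ω} {D : ℕ → ℕ → Ω → ℝ} {n : ℕ}

namespace IsIncrementArray

theorem real_passageChain_laterThresholds_le [IsProbabilityMeasure P]
    (hD : IsIncrementArray P 𝓕 D) (hU : ∀ s, {ω | s < U ω} = exceeds D s 0 n)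
    (hν : ∀ j ∈ Finset.Icc 1 l, 1 ≤ ν j) (ht : ∀ j ≤ l, 0 ≤ t j) (i : ℕ) (hi : i + 1 ≤ l) (j : ℕ) :
    P.real (passageChain D n (laterThresholds ν t i) j)
      ≤ ∏ j ∈ Finset.Icc 2 (i + 1), blockFactor P U l ν t j := by
  have hU' : ∀ s, {ω | U ω ≤ s} = (exceeds D s 0 n)ᶜ := fun s => by
    rw [← hU]; ext ω; simp
  induction i generalizing j with
  | zero => simp [laterThresholds, passageChain]
  | succ i ih =>
    have hC : 0 ≤ ∏ j ∈ Finset.Icc 2 (i + 1), blockFactor P U l ν t j :=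
      Finset.prod_nonneg fun j _ => blockFactor_nonneg j
    have hmem : i + 2 ∈ Finset.Icc 1 l := Finset.mem_Icc.mpr ⟨by omega, hi⟩
    rw [Finset.prod_Icc_succ_top (by omega : 2 ≤ i + 1 + 1), mul_comm, laterThresholds,
      blockFactor]
    split_ifs with h
    · rw [hU]
      exact hD.real_passageChain_replicate_le_pow (ht _ hi) hC (ih (by omega)) _ j
    · have hq := real_le_pos_of_notMem_indexSet hν hmem h
      rw [hU'] at hq
      refine (hD.real_passageChain_replicate_le_pow_div_factorial (ht _ hi) hC (ih (by omega))
        hq _ j).trans ?_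
      have hsum : ∑ k ∈ Finset.Ioc j n, P.real (firstHit D (t (i + 2)) 0 k)
          ≤ P.real (exceeds D (t (i + 2)) 0 n) := by
        rw [← hD.sum_real_firstHit]
        exact Finset.sum_le_sum_of_subset_of_nonneg
          (Finset.Ioc_subset_Ioc_left (Nat.zero_le j)) fun _ _ _ => measureReal_nonneg
      have hsum0 : 0 ≤ ∑ k ∈ Finset.Ioc j n, P.real (firstHit D (t (i + 2)) 0 k) :=
        Finset.sum_nonneg fun _ _ => measureReal_nonneg
      rw [hU, hU', ← Finset.sum_div, one_div_mul_eq_div]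
      have hdiv := div_le_div_of_nonneg_right hsum hq.le
      refine mul_le_mul_of_nonneg_right ?_ hC
      refine div_le_div_of_nonneg_right ?_ (Nat.cast_nonneg _)
      exact pow_le_pow_left₀ (div_nonneg hsum0 hq.le) hdiv _

theorem real_passageChain_thresholds_le [IsProbabilityMeasure P]
    (hD : IsIncrementArray P 𝓕 D) (hU : ∀ s, {ω | s < U ω} = exceeds D s 0 n) (hl : 1 ≤ l)
    (hν : ∀ j ∈ Finset.Icc 1 l, 1 ≤ ν j) (ht : ∀ j ≤ l, 0 ≤ t j) :
    P.real (passageChain D n (thresholds ν t l) 0) ≤ hjProduct P U l ν t := by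
  have hU' : ∀ s, {ω | U ω ≤ s} = (exceeds D s 0 n)ᶜ := fun s => by
    rw [← hU]; ext ω; simp
  have hmem : 1 ∈ Finset.Icc 1 l := Finset.mem_Icc.mpr ⟨le_rfl, hl⟩
  have hC : 0 ≤ ∏ j ∈ Finset.Icc 2 l, blockFactor P U l ν t j :=
    Finset.prod_nonneg fun j _ => blockFactor_nonneg j
  have hL := hD.real_passageChain_laterThresholds_le hU hν ht (l - 1) (by omega)
  rw [Nat.sub_add_cancel hl] at hL
  obtain ⟨r, hr⟩ : ∃ r, ν 1 = r + 1 := ⟨ν 1 - 1, by have := hν 1 hmem; omega⟩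
  rw [hjProduct_eq hl, thresholds, hr, Nat.add_sub_cancel, blockFactor, hr]
  by_cases h : 1 ∈ indexSet P U l ν t
  · rw [if_pos h, if_neg (not_not_intro h), pow_zero, one_mul, hU]
    exact hD.real_passageChain_first_le_pow (ht 1 hl) hC hL r
  · have hq := real_le_pos_of_notMem_indexSet hν hmem h
    rw [hU'] at hq
    rw [if_neg h, if_pos h, pow_one, hU, hU']
    exact hD.real_passageChain_first_le_pow_div_factorial (ht 1 hl) hC hL hq r

end IsIncrementArray
end Blocks

/-! ### Measurability and independence under rotations -/

section Measurability

open Matrix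

variable {m : ℕ}

instance : MeasurableSpace (Matrix (Fin m) (Fin m) ℝ) := borel _

instance : BorelSpace (Matrix (Fin m) (Fin m) ℝ) := ⟨rfl⟩

instance : SecondCountableTopology (Matrix (Fin m) (Fin m) ℝ) :=
  inferInstanceAs (SecondCountableTopology (Fin m → Fin m → ℝ))

instance : SecondCountableTopology (PosDefMatrix m) :=
  TopologicalSpace.Subtype.secondCountableTopology _

instance : MeasurableSpace (orthogonalGroup (Fin m) ℝ) := borel _

instance : BorelSpace (orthogonalGroup (Fin m) ℝ) := ⟨rfl⟩

instance : SecondCountableTopology (orthogonalGroup (Fin m) ℝ) :=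
  TopologicalSpace.Subtype.secondCountableTopology _

end Measurability

namespace PosDefMatrix

open Matrix

variable {m : ℕ}

theorem continuous_circ :
    Continuous fun p : PosDefMatrix m × PosDefMatrix m => p.1.circ p.2 := by
  refine Continuous.subtype_mk
    (f := fun p : PosDefMatrix m × PosDefMatrix m => p.1.sqrt.1 * p.2.1 * p.1.sqrt.1) ?_ _
  have h : Continuous fun p : PosDefMatrix m × PosDefMatrix m => p.1.sqrt.1 :=
    continuous_subtype_val.comp (continuous_sqrt.comp continuous_fst)
  exact (h.mul (continuous_subtype_val.comp continuous_snd)).mul h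

theorem continuous_conj :
    Continuous fun p : orthogonalGroup (Fin m) ℝ × PosDefMatrix m => conj p.1 p.2 := by
  refine Continuous.subtype_mk
    (f := fun p : orthogonalGroup (Fin m) ℝ × PosDefMatrix m => p.1.1 * p.2.1 * p.1.1ᵀ) ?_ _
  have h : Continuous fun p : orthogonalGroup (Fin m) ℝ × PosDefMatrix m => p.1.1 :=
    continuous_subtype_val.comp continuous_fst
  exact (h.mul (continuous_subtype_val.comp continuous_snd)).mul h.matrix_transpose

theorem one_circ (B : PosDefMatrix m) : (one m).circ B = B := by
  apply Subtype.ext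
  simp only [circ, sqrt_one]
  simp [one]

theorem val_circ (A B : PosDefMatrix m) : (A.circ B).1 = A.sqrt.1 * B.1 * A.sqrt.1 := rfl

theorem val_conj (k : orthogonalGroup (Fin m) ℝ) (A : PosDefMatrix m) :
    (conj k A).1 = k.1 * A.1 * k.1ᵀ := rfl

/-- The orthogonal matrix `(A ∘ B)^{-1/2} A^{1/2} B^{1/2}`, which measures the failure of
`A^{1/2} B^{1/2}` to be the positive square root of `A ∘ B`. -/
noncomputable def gyration (A B : PosDefMatrix m) : orthogonalGroup (Fin m) ℝ :=
  ⟨(A.circ B).sqrt.inv.1 * (A.sqrt.1 * B.sqrt.1), by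
    rw [mem_orthogonalGroup_iff, transpose_mul, transpose_mul, transpose_eq, transpose_eq,
      transpose_eq]
    have h : A.sqrt.1 * B.sqrt.1 * (B.sqrt.1 * A.sqrt.1)
        = (A.circ B).sqrt.1 * (A.circ B).sqrt.1 := by
      rw [sqrt_mul_self, val_circ, ← B.sqrt_mul_self]
      simp only [mul_assoc]
    calc _ = (A.circ B).sqrt.inv.1 * (A.sqrt.1 * B.sqrt.1 * (B.sqrt.1 * A.sqrt.1)) *
          (A.circ B).sqrt.inv.1 := by simp only [mul_assoc]
      _ = 1 := by
        rw [h, ← mul_assoc, inv_mul_self, one_mul, mul_inv_self]⟩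

theorem sqrt_circ_mul_gyration (A B : PosDefMatrix m) :
    (A.circ B).sqrt.1 * (gyration A B).1 = A.sqrt.1 * B.sqrt.1 := by
  rw [gyration, ← mul_assoc, mul_inv_self, one_mul]

theorem continuous_gyration :
    Continuous fun p : PosDefMatrix m × PosDefMatrix m => gyration p.1 p.2 := by
  refine Continuous.subtype_mk (f := fun p : PosDefMatrix m × PosDefMatrix m =>
    (p.1.circ p.2).sqrt.inv.1 * (p.1.sqrt.1 * p.2.sqrt.1)) ?_ _
  refine Continuous.mul ?_ (Continuous.mul ?_ ?_)
  · exact continuous_subtype_val.comp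
      (continuous_inv.comp (continuous_sqrt.comp continuous_circ))
  · exact continuous_subtype_val.comp (continuous_sqrt.comp continuous_fst)
  · exact continuous_subtype_val.comp (continuous_sqrt.comp continuous_snd)

theorem transpose_mul_orthogonal (k : orthogonalGroup (Fin m) ℝ) : k.1ᵀ * k.1 = 1 := by
  exact (mem_orthogonalGroup_iff' (Fin m) ℝ).mp k.2

theorem orthogonal_mul_transpose (k : orthogonalGroup (Fin m) ℝ) : k.1 * k.1ᵀ = 1 :=
  mul_eq_one_comm.mp (transpose_mul_orthogonal k)

theorem val_orthogonal_inv (k : orthogonalGroup (Fin m) ℝ) : (k⁻¹).1 = k.1ᵀ := by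
  change star k.1 = _
  rw [star_eq_conjTranspose, conjTranspose_eq_transpose_of_trivial]

theorem sqrt_conj (k : orthogonalGroup (Fin m) ℝ) (A : PosDefMatrix m) :
    (conj k A).sqrt = conj k A.sqrt := by
  refine sqrt_eq_of_mul_self ?_
  rw [val_conj, val_conj, ← A.sqrt_mul_self]
  calc _ = k.1 * A.sqrt.1 * (k.1ᵀ * k.1) * A.sqrt.1 * k.1ᵀ := by simp only [mul_assoc]
    _ = _ := by rw [transpose_mul_orthogonal, mul_one, mul_assoc k.1]

theorem riemannianDist_one_conj (k : orthogonalGroup (Fin m) ℝ) (A : PosDefMatrix m) :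
    (one m).riemannianDist (conj k A) = (one m).riemannianDist A := by
  rw [riemannianDist_one_left, riemannianDist_one_left, val_conj, mul_assoc, logSq_mul_comm,
    mul_assoc, transpose_mul_orthogonal, mul_one]

end PosDefMatrix

section Independence

open Matrix

variable {Ω : Type*} [mΩ : MeasurableSpace Ω] {P : Measure Ω}

/-- A sequence of σ-algebras is independent as soon as each one is independent of its past. -/
theorem iIndep_of_indep_iSup_Iio [IsProbabilityMeasure P] {𝓕 : ℕ → MeasurableSpace Ω}
    (h : ∀ i, Indep (⨆ j ∈ Set.Iio i, 𝓕 j) (𝓕 i) P) : iIndep 𝓕 P := by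
  rw [iIndep_iff]
  intro s f
  induction s using Finset.induction_on_max with
  | empty => simp
  | insert a s ha ih =>
    intro hf
    have hs : ∀ i ∈ s, MeasurableSet[𝓕 i] (f i) := fun i hi => hf i (Finset.mem_insert_of_mem hi)
    have hnot : a ∉ s := fun h => (ha a h).false
    rw [Finset.prod_insert hnot, ← ih hs, Finset.set_biInter_insert, Set.inter_comm, mul_comm]
    refine (Indep_iff _ _ _).mp (h a) _ _ ?_ (hf a (Finset.mem_insert_self a s))
    exact Finset.measurableSet_biInter _ fun i hi =>
      le_biSup 𝓕 (Set.mem_Iio.mpr (ha i hi)) _ (hs i hi)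

/-- If `X` is independent of `Y`, applying to `X` a transformation that depends on `Y`, each of which
preserves the law of `X`, keeps it independent of `Y`: the skew map `(y, x) ↦ (y, g y x)` preserves
the product law. -/
theorem indep_comap_of_forall_map_eq [IsProbabilityMeasure P] {α β : Type*}
    [mα : MeasurableSpace α] [mβ : MeasurableSpace β] {Y : Ω → α} {X : Ω → β}
    (hY : Measurable Y) (hX : Measurable X) (hYX : Indep (mα.comap Y) (mβ.comap X) P)
    {g : α → β → β} (hg : Measurable (Function.uncurry g))
    (hinv : ∀ a, P.map (fun ω => g a (X ω)) = P.map X) :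
    Indep (mα.comap Y) (mβ.comap fun ω => g (Y ω) (X ω)) P := by
  have : IsProbabilityMeasure (P.map X) := Measure.isProbabilityMeasure_map hX.aemeasurable
  have : IsProbabilityMeasure (P.map Y) := Measure.isProbabilityMeasure_map hY.aemeasurable
  have hYX' : IndepFun Y X P := (IndepFun_iff_Indep _ _ _).mpr hYX
  have hpres := (MeasurePreserving.id (P.map Y)).skew_product (μc := P.map X) (μd := P.map X)
    hg (Filter.Eventually.of_forall fun a => by
      have h1 : Measurable (g a) := hg.comp measurable_prodMk_left
      rw [Measure.map_map h1 hX]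
      exact hinv a)
  have hZ : Measurable fun ω => g (Y ω) (X ω) := hg.comp (hY.prodMk hX)
  have hjoint : P.map (fun ω => (Y ω, g (Y ω) (X ω))) = (P.map Y).prod (P.map X) := by
    rw [← hpres.map_eq, ← (indepFun_iff_map_prod_eq_prod_map_map hY.aemeasurable
      hX.aemeasurable).mp hYX', Measure.map_map hpres.measurable (hY.prodMk hX)]
    rfl
  have hmarg : P.map (fun ω => g (Y ω) (X ω)) = P.map X := by
    have h2 := congrArg Measure.snd hjoint
    rw [Measure.snd_prod, Measure.snd, Measure.map_map measurable_snd (hY.prodMk hZ)] at h2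
    exact h2
  refine (IndepFun_iff_Indep _ _ _).mp ?_
  rw [indepFun_iff_map_prod_eq_prod_map_map hY.aemeasurable hZ.aemeasurable, hjoint, hmarg]

theorem PosDefMatrix.measurable_uncurry_conj {m : ℕ} {α : Type*} [MeasurableSpace α]
    {k : α → orthogonalGroup (Fin m) ℝ} (hk : Measurable k) :
    Measurable (Function.uncurry fun a x => PosDefMatrix.conj (k a) x) := by
  have hc := (PosDefMatrix.continuous_conj (m := m)).measurable
  have hk' : Measurable fun p : α × PosDefMatrix m => (k p.1, p.2) :=
    (hk.comp measurable_fst).prodMk measurable_snd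
  have h := hc.comp hk'
  exact h

/-- An orthogonally invariant matrix that is independent of `𝓖` remains so after conjugation by a
`𝓖`-measurable orthogonal matrix. -/
theorem indep_comap_conj {m : ℕ} {Ω : Type*} {𝓖 : MeasurableSpace Ω} [mΩ : MeasurableSpace Ω]
    {P : Measure Ω} [IsProbabilityMeasure P] (h𝓖 : 𝓖 ≤ mΩ)
    {X : Ω → PosDefMatrix m} (hX : Measurable X) (hind : Indep 𝓖 (.comap X inferInstance) P)
    (hinv : OrthogonallyInvariant P X) {k : Ω → orthogonalGroup (Fin m) ℝ}
    (hk : Measurable[𝓖] k) :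
    Indep 𝓖 (.comap (fun ω => PosDefMatrix.conj (k ω) (X ω)) inferInstance) P := by
  have h := @indep_comap_of_forall_map_eq Ω mΩ P _ Ω (PosDefMatrix m) 𝓖 _ id X
    (measurable_id'' h𝓖) hX (by rwa [MeasurableSpace.comap_id]) _
    (@PosDefMatrix.measurable_uncurry_conj m Ω 𝓖 k hk)
    (fun ω => (hinv (k ω)).map_eq)
  rwa [MeasurableSpace.comap_id] at h

end Independence

/-! ### The moving frame of the walk -/

section Frames

open Matrix

variable {m : ℕ} {Ω : Type*}

/-- The walk `S_0, S_1, S_2, …` with its starting point `S_0 = I` included. -/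
noncomputable def walk (X : ℕ → Ω → PosDefMatrix m) : ℕ → Ω → PosDefMatrix m
  | 0, _ => PosDefMatrix.one m
  | i + 1, ω => partialCirc X i ω

theorem walk_succ (X : ℕ → Ω → PosDefMatrix m) (i : ℕ) (ω : Ω) :
    walk X (i + 1) ω = (walk X i ω).circ (X i ω) := by
  cases i with
  | zero => exact (PosDefMatrix.one_circ _).symm
  | succ i => rfl

/-- The accumulated gyrations `u_0, u_1, …`, so that `S_i^{1/2} u_i` is a plain product of
square roots of the rotated steps `u_j' X_j u_j`. -/
noncomputable def walkRotation (X : ℕ → Ω → PosDefMatrix m) : ℕ → Ω → orthogonalGroup (Fin m) ℝ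
  | 0, _ => 1
  | i + 1, ω => PosDefMatrix.gyration (walk X i ω) (X i ω) * walkRotation X i ω

/-- The steps `u_i' X_i u_i` of the walk, seen in the moving frame. -/
noncomputable def rotatedStep (X : ℕ → Ω → PosDefMatrix m) (i : ℕ) (ω : Ω) : PosDefMatrix m :=
  PosDefMatrix.conj (walkRotation X i ω)⁻¹ (X i ω)

/-- The moving frame `S_i^{1/2} u_i`. -/
noncomputable def walkFrame (X : ℕ → Ω → PosDefMatrix m) (i : ℕ) (ω : Ω) :
    Matrix (Fin m) (Fin m) ℝ :=
  (walk X i ω).sqrt.1 * (walkRotation X i ω).1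

/-- The product `Z_j^{1/2} Z_{j+1}^{1/2} ⋯ Z_{j+d-1}^{1/2}`. -/
noncomputable def sqrtProd (Z : ℕ → Ω → PosDefMatrix m) (j : ℕ) :
    ℕ → Ω → Matrix (Fin m) (Fin m) ℝ
  | 0, _ => 1
  | d + 1, ω => sqrtProd Z j d ω * (Z (j + d) ω).sqrt.1

theorem isUnit_sqrtProd (Z : ℕ → Ω → PosDefMatrix m) (j d : ℕ) (ω : Ω) :
    IsUnit (sqrtProd Z j d ω) := by
  induction d with
  | zero => exact isUnit_one
  | succ d ih => exact ih.mul (Z (j + d) ω).sqrt.2.isUnit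

/-- The positive definite matrix `q qᵀ` for the product `q = sqrtProd Z j d`. -/
noncomputable def sqrtProdGram (Z : ℕ → Ω → PosDefMatrix m) (j d : ℕ) (ω : Ω) : PosDefMatrix m :=
  ⟨sqrtProd Z j d ω * (sqrtProd Z j d ω)ᵀ, by
    have h := PosDef.one.transpose_mul_mul_same (M := (sqrtProd Z j d ω)ᵀ)
      (by
        rw [isUnit_iff_isUnit_det, det_transpose, ← isUnit_iff_isUnit_det]
        exact isUnit_sqrtProd Z j d ω)
    rwa [transpose_transpose, mul_one] at h⟩

variable (X : ℕ → Ω → PosDefMatrix m)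

theorem walkFrame_succ (i : ℕ) (ω : Ω) :
    walkFrame X (i + 1) ω = walkFrame X i ω * (rotatedStep X i ω).sqrt.1 := by
  rw [walkFrame, walkFrame, walk_succ, walkRotation, rotatedStep, PosDefMatrix.sqrt_conj,
    PosDefMatrix.val_conj, PosDefMatrix.val_orthogonal_inv, transpose_transpose,
    Submonoid.coe_mul, ← mul_assoc, PosDefMatrix.sqrt_circ_mul_gyration]
  calc _ = (walk X i ω).sqrt.1 * ((walkRotation X i ω).1 * (walkRotation X i ω).1ᵀ) *
        (X i ω).sqrt.1 * (walkRotation X i ω).1 := by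
        rw [PosDefMatrix.orthogonal_mul_transpose, mul_one]
    _ = _ := by simp only [mul_assoc]

theorem walkFrame_add (j d : ℕ) (ω : Ω) :
    walkFrame X (j + d) ω = walkFrame X j ω * sqrtProd (rotatedStep X) j d ω := by
  induction d with
  | zero => simp [sqrtProd]
  | succ d ih => rw [← add_assoc, walkFrame_succ, ih, sqrtProd, mul_assoc]

theorem walkFrame_mul_transpose (i : ℕ) (ω : Ω) :
    walkFrame X i ω * (walkFrame X i ω)ᵀ = (walk X i ω).1 := by
  rw [walkFrame, transpose_mul, PosDefMatrix.transpose_eq]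
  calc _ = (walk X i ω).sqrt.1 * ((walkRotation X i ω).1 * (walkRotation X i ω).1ᵀ) *
        (walk X i ω).sqrt.1 := by simp only [mul_assoc]
    _ = _ := by rw [PosDefMatrix.orthogonal_mul_transpose, mul_one, PosDefMatrix.sqrt_mul_self]

/-- The distance between two positions of the walk only involves the rotated steps between them. -/
theorem riemannianDist_walk_add (j d : ℕ) (ω : Ω) :
    (walk X j ω).riemannianDist (walk X (j + d) ω)
      = (PosDefMatrix.one m).riemannianDist (sqrtProdGram (rotatedStep X) j d ω) := by
  refine PosDefMatrix.riemannianDist_congr (g := walkFrame X j ω)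
    (walkFrame_mul_transpose X j ω).symm ?_
  rw [← walkFrame_mul_transpose, walkFrame_add, transpose_mul, sqrtProdGram]
  simp only [mul_assoc]

theorem riemannianDist_walk_succ (i : ℕ) (ω : Ω) :
    (walk X i ω).riemannianDist (walk X (i + 1) ω)
      = (PosDefMatrix.one m).riemannianDist (X i ω) := by
  have h : sqrtProdGram (rotatedStep X) i 1 ω = rotatedStep X i ω := by
    apply Subtype.ext
    simp only [sqrtProdGram, sqrtProd, one_mul, add_zero]
    rw [PosDefMatrix.transpose_eq, PosDefMatrix.sqrt_mul_self]
  rw [riemannianDist_walk_add, h, rotatedStep, PosDefMatrix.riemannianDist_one_conj]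

theorem PosDefMatrix.measurable_of_val [MeasurableSpace Ω] {f : Ω → PosDefMatrix m}
    (hf : Measurable fun ω => (f ω).1) : Measurable f := by
  have h : borel (PosDefMatrix m)
      = MeasurableSpace.comap Subtype.val (borel (Matrix (Fin m) (Fin m) ℝ)) := borel_comap
  rw [measurable_iff_comap_le]
  change MeasurableSpace.comap f (borel (PosDefMatrix m)) ≤ _
  rw [h, MeasurableSpace.comap_comp, ← measurable_iff_comap_le]
  exact hf

theorem measurable_sqrtProd [MeasurableSpace Ω] {Z : ℕ → Ω → PosDefMatrix m} {j d : ℕ}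
    (hZ : ∀ i ∈ Set.Ico j (j + d), Measurable (Z i)) : Measurable (sqrtProd Z j d) := by
  induction d with
  | zero => exact measurable_const
  | succ d ih =>
    have h1 := ih fun i hi => hZ i ⟨hi.1, hi.2.trans (by omega)⟩
    have h2 : Measurable fun ω => (Z (j + d) ω).sqrt.1 :=
      (continuous_subtype_val.comp PosDefMatrix.continuous_sqrt).measurable.comp
        (hZ (j + d) ⟨by omega, by omega⟩)
    have hmul : Continuous fun p : Matrix (Fin m) (Fin m) ℝ × Matrix (Fin m) (Fin m) ℝ =>
      p.1 * p.2 := continuous_fst.mul continuous_snd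
    exact hmul.measurable.comp (h1.prodMk h2)

theorem measurable_sqrtProdGram [MeasurableSpace Ω] {Z : ℕ → Ω → PosDefMatrix m} {j d : ℕ}
    (hZ : ∀ i ∈ Set.Ico j (j + d), Measurable (Z i)) : Measurable (sqrtProdGram Z j d) := by
  refine PosDefMatrix.measurable_of_val ?_
  have h : Continuous fun q : Matrix (Fin m) (Fin m) ℝ => q * qᵀ :=
    continuous_id.mul continuous_id.matrix_transpose
  exact h.measurable.comp (measurable_sqrtProd hZ)

variable {X}

theorem measurable_walk [MeasurableSpace Ω] {i : ℕ} (hX : ∀ j < i, Measurable (X j)) :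
    Measurable (walk X i) := by
  induction i with
  | zero => exact measurable_const
  | succ i ih =>
    have h := (PosDefMatrix.continuous_circ (m := m)).measurable.comp
      ((ih fun j hj => hX j (by omega)).prodMk (hX i (by omega)))
    have he : walk X (i + 1) = fun ω => (walk X i ω).circ (X i ω) := funext (walk_succ X i)
    rw [he]
    exact h

theorem measurable_walkRotation [MeasurableSpace Ω] {i : ℕ} (hX : ∀ j < i, Measurable (X j)) :
    Measurable (walkRotation X i) := by
  induction i with
  | zero => exact measurable_const
  | succ i ih =>
    have h1 := (PosDefMatrix.continuous_gyration (m := m)).measurable.comp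
      ((measurable_walk (i := i) fun j hj => hX j (by omega)).prodMk (hX i (by omega)))
    have h2 := ih fun j hj => hX j (by omega)
    have hmul : Continuous fun p : orthogonalGroup (Fin m) ℝ × orthogonalGroup (Fin m) ℝ =>
      p.1 * p.2 := continuous_fst.mul continuous_snd
    have h := hmul.measurable.comp (h1.prodMk h2)
    exact h

theorem measurable_walkRotation_inv [MeasurableSpace Ω] {i : ℕ}
    (hX : ∀ j < i, Measurable (X j)) : Measurable fun ω => (walkRotation X i ω)⁻¹ := by
  have h : Continuous fun k : orthogonalGroup (Fin m) ℝ => k⁻¹ := by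
    refine continuous_induced_rng.mpr ?_
    have : Continuous fun k : orthogonalGroup (Fin m) ℝ => k.1ᵀ :=
      continuous_subtype_val.matrix_transpose
    exact this
  have h' := h.measurable.comp (measurable_walkRotation hX)
  exact h'

theorem measurable_rotatedStep [MeasurableSpace Ω] {i : ℕ} (hX : ∀ j ≤ i, Measurable (X j)) :
    Measurable (rotatedStep X i) := by
  have h := (PosDefMatrix.continuous_conj (m := m)).measurable.comp
    ((measurable_walkRotation_inv fun j hj => hX j hj.le).prodMk (hX i le_rfl))
  exact h

/-- The rotated steps are again independent: each rotation is a function of the past, and the steps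
are orthogonally invariant. -/
theorem iIndep_rotatedStep [MeasurableSpace Ω] {P : Measure Ω} [IsProbabilityMeasure P]
    (hmeas : ∀ i, Measurable (X i)) (hindep : iIndepFun X P)
    (hinv : ∀ i, OrthogonallyInvariant P (X i)) :
    iIndep (fun i => MeasurableSpace.comap (rotatedStep X i) inferInstance) P := by
  refine iIndep_of_indep_iSup_Iio fun i => ?_
  have hle : ⨆ j ∈ Set.Iio i, MeasurableSpace.comap (X j) inferInstance
      ≤ (inferInstance : MeasurableSpace Ω) := iSup₂_le fun j _ => (hmeas j).comap_le
  have hXm : ∀ j < i, Measurable[⨆ j ∈ Set.Iio i, MeasurableSpace.comap (X j) inferInstance]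
      (X j) := fun j hj => measurable_iff_comap_le.mpr
        (le_biSup (fun j => MeasurableSpace.comap (X j) inferInstance) (Set.mem_Iio.mpr hj))
  have hind : Indep (⨆ j ∈ Set.Iio i, MeasurableSpace.comap (X j) inferInstance)
      (MeasurableSpace.comap (X i) inferInstance) P := by
    have h := indep_iSup_of_disjoint (fun j => (hmeas j).comap_le) hindep.iIndep
      (S := Set.Iio i) (T := {i}) (by simp)
    simpa using h
  refine indep_of_indep_of_le_left (indep_comap_conj hle (hmeas i) hind (hinv i)
    (@measurable_walkRotation_inv m Ω X
      (⨆ j ∈ Set.Iio i, MeasurableSpace.comap (X j) inferInstance) i hXm)) ?_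
  refine iSup₂_le fun j hj => measurable_iff_comap_le.mp ?_
  exact @measurable_rotatedStep m Ω X
    (⨆ j ∈ Set.Iio i, MeasurableSpace.comap (X j) inferInstance) j fun k hk => hXm k (hk.trans_lt hj)

theorem isIncrementArray_walk [MeasurableSpace Ω] {P : Measure Ω} [IsProbabilityMeasure P]
    (hmeas : ∀ i, Measurable (X i)) (hindep : iIndepFun X P)
    (hinv : ∀ i, OrthogonallyInvariant P (X i)) :
    IsIncrementArray P (fun i => MeasurableSpace.comap (rotatedStep X i) inferInstance)
      fun j k ω => (walk X j ω).riemannianDist (walk X k ω) where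
  le i := (measurable_rotatedStep fun j _ => hmeas j).comap_le
  iIndep := iIndep_rotatedStep hmeas hindep hinv
  measurable {j k} hjk := by
    obtain ⟨d, rfl⟩ := Nat.exists_eq_add_of_le hjk
    simp only [riemannianDist_walk_add]
    refine PosDefMatrix.continuous_riemannianDist_one.measurable.comp
      (@measurable_sqrtProdGram m Ω
      (⨆ i ∈ Set.Ico j (j + d), MeasurableSpace.comap (rotatedStep X i) inferInstance) _ j d
      fun i hi => ?_)
    exact measurable_iff_comap_le.mpr
      (le_biSup (fun i => MeasurableSpace.comap (rotatedStep X i) inferInstance) hi)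
  self j ω := PosDefMatrix.riemannianDist_self _
  triangle _ _ ω := PosDefMatrix.riemannianDist_triangle _ _ _
  triangle_zero {j k} _ ω := by
    have h := PosDefMatrix.riemannianDist_triangle (walk X j ω) (PosDefMatrix.one m) (walk X k ω)
    rwa [PosDefMatrix.riemannianDist_one_right] at h

end Frames

/-! ### Order statistics and the conclusion -/

section OrderStatistics

variable {n K : ℕ}

theorem card_filter_top (hK : 1 ≤ K) (hKn : K ≤ n + 1) :
    (Finset.univ.filter fun i : Fin n => n + 2 ≤ (i.val + 1) + K).card = K - 1 := by
  have h : (Finset.univ.filter fun i : Fin n => n + 2 ≤ (i.val + 1) + K).map Fin.valEmbedding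
      = Finset.Ico (n + 1 - K) n := by
    ext i
    simp only [Finset.mem_map, Finset.mem_filter, Finset.mem_univ, true_and, Fin.valEmbedding_apply,
      Finset.mem_Ico]
    constructor
    · rintro ⟨j, hj, rfl⟩
      have := j.2
      omega
    · rintro ⟨h1, h2⟩
      exact ⟨⟨i, h2⟩, by dsimp only; omega, rfl⟩
  rw [← Finset.card_map Fin.valEmbedding, h, Nat.card_Ico]
  omega

/-- A sum over at most `#T` terms is at most the sum over `T`, when `T` carries the largest
values. -/
theorem sum_le_sum_of_card_le {ι : Type*} [DecidableEq ι] {z : ι → ℝ} (hz : ∀ i, 0 ≤ z i)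
    {J T : Finset ι} (hcard : J.card ≤ T.card) (hT : ∀ i ∉ T, ∀ j ∈ T, z i ≤ z j) :
    ∑ i ∈ J, z i ≤ ∑ i ∈ T, z i := by
  have hc : (J \ T).card ≤ (T \ J).card := by
    have h1 := Finset.card_sdiff_add_card_inter J T
    have h2 := Finset.card_sdiff_add_card_inter T J
    rw [Finset.inter_comm] at h2
    omega
  have hmain : ∑ i ∈ J \ T, z i ≤ ∑ i ∈ T \ J, z i := by
    rcases (J \ T).eq_empty_or_nonempty with he | hne
    · rw [he, Finset.sum_empty]
      exact Finset.sum_nonneg fun i _ => hz i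
    · obtain ⟨a, ha, hmax⟩ := (J \ T).exists_max_image z hne
      calc ∑ i ∈ J \ T, z i ≤ (J \ T).card • z a := Finset.sum_le_card_nsmul _ _ _ hmax
        _ ≤ (T \ J).card • z a := by
          rw [nsmul_eq_mul, nsmul_eq_mul]
          exact mul_le_mul_of_nonneg_right (by exact_mod_cast hc) (hz a)
        _ ≤ ∑ i ∈ T \ J, z i := Finset.card_nsmul_le_sum _ _ _ fun j hj =>
          hT a (Finset.mem_sdiff.mp ha).2 j (Finset.mem_sdiff.mp hj).1
  rw [← Finset.sum_inter_add_sum_sdiff J T, ← Finset.sum_inter_add_sum_sdiff T J,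
    Finset.inter_comm T J]
  linarith

theorem sum_le_topOrderStatSum {y : Fin n → ℝ} (hy : ∀ i, 0 ≤ y i) (hK : 1 ≤ K) (hKn : K ≤ n + 1)
    {J : Finset (Fin n)} (hJ : J.card + 1 ≤ K) : ∑ i ∈ J, y i ≤ topOrderStatSum y K := by
  have hmono : Monotone (orderStat y) := Tuple.monotone_sort y
  have h : ∑ i ∈ J, y i = ∑ i ∈ J.map (Tuple.sort y).symm.toEmbedding, orderStat y i := by
    simp [orderStat]
  rw [h, topOrderStatSum]
  refine sum_le_sum_of_card_le (fun i => hy _) ?_ fun i hi j hj => hmono ?_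
  · rw [card_filter_top hK hKn, Finset.card_map]
    omega
  · rw [Finset.mem_filter] at hi hj
    have h1 := hj.2
    have h2 : ¬ n + 2 ≤ (i.val + 1) + K := fun h => hi ⟨Finset.mem_univ _, h⟩
    rw [Fin.le_def]
    omega

theorem topOrderStatSum_le {y : Fin n → ℝ} {M : ℝ} (hy : ∀ i, y i ≤ M) (hK : 1 ≤ K)
    (hKn : K ≤ n + 1) : topOrderStatSum y K ≤ ((K : ℝ) - 1) * M := by
  have h := Finset.sum_le_card_nsmul
    (Finset.univ.filter fun i : Fin n => n + 2 ≤ (i.val + 1) + K) (orderStat y) M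
    fun i _ => hy _
  rwa [card_filter_top hK hKn, nsmul_eq_mul, Nat.cast_sub hK, Nat.cast_one] at h

end OrderStatistics

section Conclusion

variable {m : ℕ} {Ω : Type*} (X : ℕ → Ω → PosDefMatrix m) {n : ℕ}

theorem setOf_lt_maxWalk (hn : 1 ≤ n) (s : ℝ) :
    {ω | s < maxWalk X n ω}
      = exceeds (fun j k ω => (walk X j ω).riemannianDist (walk X k ω)) s 0 n := by
  have : Nonempty (Fin n) := ⟨⟨0, hn⟩⟩
  ext ω
  simp only [exceeds, Set.mem_ofPred_eq, maxWalk]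
  rw [lt_ciSup_iff (Set.finite_range _).bddAbove]
  constructor
  · rintro ⟨i, hi⟩
    exact ⟨i + 1, Finset.mem_Ioc.mpr ⟨by omega, i.2⟩, hi⟩
  · rintro ⟨k, hk, hlt⟩
    rw [Finset.mem_Ioc] at hk
    obtain ⟨i, rfl⟩ : ∃ i, k = i + 1 := ⟨k - 1, by omega⟩
    exact ⟨⟨i, hk.2⟩, hlt⟩

theorem topOrderStatSum_stepDist_le {K : ℕ} (hK : 1 ≤ K) (hKn : K ≤ n + 1) (ω : Ω) :
    topOrderStatSum (stepDist X n ω) K ≤ ((K : ℝ) - 1) * maxStep X n ω :=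
  topOrderStatSum_le (fun i => le_ciSup (Set.finite_range _).bddAbove i) hK hKn

theorem sum_riemannianDist_walk_le {K : ℕ} (hK : 1 ≤ K) (hKn : K ≤ n + 1) (ω : Ω) {J : Finset ℕ}
    (hJ : J ⊆ Finset.Ico 0 n) (hcard : J.card + 1 ≤ K) :
    ∑ i ∈ J, (walk X i ω).riemannianDist (walk X (i + 1) ω)
      ≤ topOrderStatSum (stepDist X n ω) K := by
  have hlt : ∀ i ∈ J, i < n := fun i hi => (Finset.mem_Ico.mp (hJ hi)).2
  have h : ∑ i ∈ J, (walk X i ω).riemannianDist (walk X (i + 1) ω)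
      = ∑ i ∈ J.attachFin hlt, stepDist X n ω i := by
    have hmap := Finset.sum_map (J.attachFin hlt) Fin.valEmbedding
      (fun i => (PosDefMatrix.one m).riemannianDist (X i ω))
    rw [Finset.map_valEmbedding_attachFin] at hmap
    exact (Finset.sum_congr rfl fun i _ => riemannianDist_walk_succ X i ω).trans hmap
  rw [h]
  refine sum_le_topOrderStatSum (fun i => PosDefMatrix.riemannianDist_nonneg _ _) hK hKn ?_
  rwa [Finset.card_attachFin]

end Conclusion

theorem theorem1 {Ω : Type*} [MeasurableSpace Ω] (P : Measure Ω) [IsProbabilityMeasure P]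
    (m : ℕ) (X : ℕ → Ω → PosDefMatrix m)
    (hmeas : ∀ i, Measurable (X i))
    (hindep : iIndepFun X P)
    (hident : ∀ i, IdentDistrib (X i) (X 0) P P)
    (hinv : ∀ i, OrthogonallyInvariant P (X i))
    (n l : ℕ) (hn : 1 ≤ n) (hl : 1 ≤ l)
    (ν : ℕ → ℕ) (hν : ∀ j ∈ Finset.Icc 1 l, 1 ≤ ν j)
    (t : ℕ → ℝ) (ht : ∀ j ≤ l, 0 ≤ t j)
    (K : ℕ) (hK : K = ∑ j ∈ Finset.Icc 1 l, ν j) (hKn : K ≤ n + 1) :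
    P.real {ω | ((K : ℝ) - 1) * t 0 + (2 * (ν 1 : ℝ) - 1) * t 1
          + 2 * ∑ j ∈ Finset.Icc 2 l, (ν j : ℝ) * t j < maxWalk X n ω}
        ≤ P.real {ω | t 0 < maxStep X n ω} + hjProduct P (maxWalk X n) l ν t ∧
    P.real {ω | ((K : ℝ) - 1) * t 0 + (2 * (ν 1 : ℝ) - 1) * t 1
          + 2 * ∑ j ∈ Finset.Icc 2 l, (ν j : ℝ) * t j < maxWalk X n ω}
        ≤ P.real {ω | ((K : ℝ) - 1) * t 0 < topOrderStatSum (stepDist X n ω) K}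
          + hjProduct P (maxWalk X n) l ν t ∧
    P.real {ω | ((K : ℝ) - 1) * t 0 < topOrderStatSum (stepDist X n ω) K}
        ≤ P.real {ω | t 0 < maxStep X n ω} := by
  have h1mem : 1 ∈ Finset.Icc 1 l := Finset.mem_Icc.mpr ⟨le_rfl, hl⟩
  have hν1 := hν 1 h1mem
  have hK1 : 1 ≤ K := hK ▸ hν1.trans (Finset.single_le_sum (fun _ _ => Nat.zero_le _) h1mem)
  have hD := isIncrementArray_walk hmeas hindep hinv
  have hsecond : P.real {ω | ((K : ℝ) - 1) * t 0 + (2 * (ν 1 : ℝ) - 1) * t 1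
          + 2 * ∑ j ∈ Finset.Icc 2 l, (ν j : ℝ) * t j < maxWalk X n ω}
        ≤ P.real {ω | ((K : ℝ) - 1) * t 0 < topOrderStatSum (stepDist X n ω) K}
          + hjProduct P (maxWalk X n) l ν t := by
    refine le_trans ?_ (add_le_add_right
      (hD.real_passageChain_thresholds_le (setOf_lt_maxWalk X hn) hl hν ht) _)
    refine (measureReal_mono ?_ (measure_ne_top _ _)).trans (measureReal_union_le _ _)
    rw [setOf_lt_maxWalk X hn]
    rintro ω ⟨k, hk, hlt⟩
    rw [Finset.mem_Ioc] at hk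
    by_contra hcon
    rw [Set.mem_union, not_or] at hcon
    obtain ⟨htop, hchain⟩ := hcon
    obtain ⟨J, hJ, hcard, hle⟩ := hD.exists_le_sum_of_notMem_passageChain _ 0
      (nonneg_of_mem_thresholds hl ht) hchain (Nat.zero_le k) hk.2
    rw [length_thresholds hl hν1, ← hK] at hcard
    rw [sum_thresholds hl hν1] at hle
    have hsum := sum_riemannianDist_walk_le X hK1 hKn ω hJ hcard
    have htop' : topOrderStatSum (stepDist X n ω) K ≤ ((K : ℝ) - 1) * t 0 := not_lt.mp htop
    linarith
  have hthird : P.real {ω | ((K : ℝ) - 1) * t 0 < topOrderStatSum (stepDist X n ω) K}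
        ≤ P.real {ω | t 0 < maxStep X n ω} := by
    refine measureReal_mono (fun ω hω => ?_) (measure_ne_top _ _)
    have hω' : ((K : ℝ) - 1) * t 0 < topOrderStatSum (stepDist X n ω) K := hω
    have hK0 : (0 : ℝ) ≤ K - 1 := by
      rw [sub_nonneg]
      exact_mod_cast hK1
    exact lt_of_mul_lt_mul_left (hω'.trans_le (topOrderStatSum_stepDist_le X hK1 hKn ω)) hK0
  exact ⟨hsecond.trans (add_le_add_left hthird _), hsecond, hthird⟩
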